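/- Conventions. A link diagram is a planar oriented diagram $D$ (a plane $4$-valent graph with over/under information at the crossings, possibly disconnected and possibly with components without crossings). Its Seifert graph is the multigraph whose vertices are the Seifert circles and whose edges are the crossings, the crossing $x$ joining the two Seifert circles that come near to each other at $x$; the sign of an edge is the type (positive or negative) of the oriented crossing. The blocks of a graph are its maximal connected subgraphs without a cut vertex. $D$ is homogeneous if in each block of its Seifert graph all edges have the same sign; a link is homogeneous if it has a homogeneous diagram. Draw a crossing $c$ in a small square with its four half-edges at the corners NE, NW, SW, SE (in any of the four positions). The (unoriented) sign of $c$ in this square is $+1$ or $-1$ according to whether its over-strand joins NE and SW or joins NW and SE. A rational tangle of a continued fraction $[a_1,\dots,a_n]$, $n\ge 1$, with non-zero denominators of the same sign $\varepsilon$ is drawn as usual, by boxes of $|a_1|,\dots,|a_n|$ twists that are horizontal and vertical in turn, all the crossings having sign $\varepsilon$ in the square. A block of rational tangles is built from finitely many such tangles by sums (side by side) and products (one on top of the other), in any combination. The block extends $c$ if the denominators of each of its rational tangles have the same sign as $c$. Theorem. Let $D$ be a homogeneous diagram of a link $L$, let $c$ be an oriented crossing of $D$ drawn in a square as above, and let $b$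 be a block of rational tangles that extends $c$, with any orientation that agrees with the orientation of $c$ at the four corners of the square. Let $D^{*}$ be the oriented diagram obtained from $D$ by replacing $c$ by $b$. Then $D^{*}$ is again a planar diagram, and it is homogeneous. In particular the link $L^{*}$ with diagram $D^{*}$ is homogeneous. (No further condition on the types of the crossings in the boxes is needed; so the theorem includes the oriented blocks for which, in each rational tangle of the block, the crossings of the $i$-th box have the type of $c$ for odd $i$ and the opposite type for even $i$.) -/

import Mathlib

/-! ### Multigraphs: connectedness, cut vertices, blocks -/

namespace Graph

variable {α β : Type*}

/-- A multigraph is connected: it has a vertex, and any two vertices are joined by a walk. -/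
def IsConnected (G : Graph α β) : Prop :=
  G.vertexSet.Nonempty ∧
    ∀ x ∈ G.vertexSet, ∀ y ∈ G.vertexSet, Relation.ReflTransGen G.Adj x y

/-- `G` can be cut at the vertex `v`: it is the union of two edge-disjoint subgraphs, each with at
least one edge, whose only common vertex is `v`. In a connected graph without loops these are
exactly the vertices whose removal increases the number of components. (Seifert graphs of planar
diagrams have no loops; with this convention a loop would be a block by itself.) -/
def IsCutVertex (G : Graph α β) (v : α) : Prop :=
  ∃ H K : Graph α β, H ≤ G ∧ K ≤ G ∧
    H.vertexSet ∪ K.vertexSet = G.vertexSet ∧ H.edgeSet ∪ K.edgeSet = G.edgeSet ∧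
    Disjoint H.edgeSet K.edgeSet ∧ H.edgeSet.Nonempty ∧ K.edgeSet.Nonempty ∧
    H.vertexSet ∩ K.vertexSet = {v}

/-- The blocks of `G`: the maximal connected subgraphs without a cut vertex. -/
def IsBlock (G B : Graph α β) : Prop :=
  Maximal (fun H : Graph α β => H ≤ G ∧ H.IsConnected ∧ ∀ v, ¬ H.IsCutVertex v) B

end Graph

/-! ### Link diagrams

A crossing is drawn inside a small square. Its four half-edges point to the corners, numbered
counterclockwise: `0 = NE`, `1 = NW`, `2 = SW`, `3 = SE`. -/

/-- The unoriented diagrams, as combinatorial `4`-valent maps on oriented surfaces. `sign x = 1`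
if the over-strand of `x` joins NE to SW, and `sign x = -1` if it joins NW to SE. (So turning the
square of a crossing by a quarter changes its sign, and each crossing of a diagram may be presented
in any of the four positions.) `glue h` is the half-edge at the other end of the arc that starts
with `h`. The number of components without crossings is `circles`. -/
structure Diagram where
  Crossing : Type
  finite : Finite Crossing
  sign : Crossing → ℤˣ
  glue : Crossing × Fin 4 → Crossing × Fin 4
  glue_glue : ∀ h, glue (glue h) = h
  glue_ne : ∀ h, glue h ≠ h
  circles : ℕ

namespace Diagram

/-- The faces (counted separately on each connected component of the underlying `4`-valent graph):
arriving at a crossing through a half-edge, one leaves through the next one in cyclic order. -/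
def Face (D : Diagram) : Type :=
  Quot fun h h' : D.Crossing × Fin 4 => h' = ((D.glue h).1, (D.glue h).2 + 1)

/-- The connected components of the underlying `4`-valent graph. -/
def Component (D : Diagram) : Type :=
  Quot fun x y : D.Crossing => ∃ i j, D.glue (x, i) = (y, j)

/-- The diagram lies in the plane (equivalently the sphere): Euler's formula
`V - E + F = 2 C` holds, where `E = 2 V`. -/
def IsPlanar (D : Diagram) : Prop :=
  Nat.card D.Face = Nat.card D.Crossing + 2 * Nat.card D.Component

end Diagram

/-- A diagram with an orientation: `out h` says that the strand on the half-edge `h` points away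
from the crossing. -/
structure OrientedDiagram extends Diagram where
  out : Crossing × Fin 4 → Bool
  out_opposite : ∀ x i, out (x, i + 2) = !out (x, i)
  out_glue : ∀ h, out (glue h) = !out h

namespace OrientedDiagram

/-- The type of an oriented crossing, `1` if it is positive (right-handed) and `-1` if it is
negative. When both strands run upwards or both run downwards (NE and NW are both outgoing or both
incoming), the crossing is positive iff the over-strand joins SW and NE; otherwise both run to the
right or both to the left, and it is the other way around. -/
def crossingType (D : OrientedDiagram) (x : D.Crossing) : ℤˣ :=
  if D.out (x, 0) = D.out (x, 1) then D.sign x else -D.sign x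

/-- The Seifert circles that pass through some crossing: one travels along the arcs of the diagram,
and at a crossing one passes to the neighbouring half-edge of the opposite direction. -/
def SeifertCircle (D : OrientedDiagram) : Type :=
  Quot fun h h' : D.Crossing × Fin 4 =>
    h' = D.glue h ∨ (h' = (h.1, h.2 + 1) ∧ D.out h' ≠ D.out h)

/-- The Seifert graph. The vertices are the Seifert circles, including the components without
crossings. The edges are the crossings; the crossing `x` joins the two circles (the one through its
NE corner and the one through its SW corner) that come near to each other at `x`. -/
def seifertGraph (D : OrientedDiagram) : Graph (D.SeifertCircle ⊕ Fin D.circles) D.Crossing where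
  vertexSet := Set.univ
  IsLink x u v :=
    (u = Sum.inl (Quot.mk _ (x, 0)) ∧ v = Sum.inl (Quot.mk _ (x, 2))) ∨
    (u = Sum.inl (Quot.mk _ (x, 2)) ∧ v = Sum.inl (Quot.mk _ (x, 0)))
  isLink_symm := by
    intro e _
    exact ⟨fun u v h => h.elim (fun h => Or.inr ⟨h.2, h.1⟩) (fun h => Or.inl ⟨h.2, h.1⟩)⟩
  eq_or_eq_of_isLink_of_isLink := by
    rintro e x y v w (⟨rfl, rfl⟩ | ⟨rfl, rfl⟩) (⟨rfl, rfl⟩ | ⟨rfl, rfl⟩)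
    exacts [Or.inl rfl, Or.inr rfl, Or.inr rfl, Or.inl rfl]
  left_mem_of_isLink := fun _ _ _ _ => Set.mem_univ _

/-- In each block of the Seifert graph all edges have the same sign, the sign of an edge being the
type of the crossing. -/
def IsHomogeneous (D : OrientedDiagram) : Prop :=
  ∀ B, D.seifertGraph.IsBlock B →
    ∀ x ∈ B.edgeSet, ∀ y ∈ B.edgeSet, D.crossingType x = D.crossingType y

end OrientedDiagram

/-! ### Tangles -/

/-- Tangle diagrams in a square in which each strand meets a crossing (as all strands of a block of
rational tangles do). The ends at the corners of the square are numbered like those of a crossing.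
`tip i` is the half-edge of a crossing to which the end `i` is attached. `glue h` is the other end
of the arc that starts with `h`: a half-edge, or one of the four ends. -/
structure Tangle where
  Crossing : Type
  finite : Finite Crossing
  sign : Crossing → ℤˣ
  tip : Fin 4 → Crossing × Fin 4
  glue : Crossing × Fin 4 → (Crossing × Fin 4) ⊕ Fin 4
  glue_tip : ∀ i, glue (tip i) = Sum.inr i
  tip_of_glue : ∀ h i, glue h = Sum.inr i → h = tip i
  glue_glue : ∀ h h', glue h = Sum.inl h' → glue h' = Sum.inl h
  glue_ne : ∀ h, glue h ≠ Sum.inl h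

namespace Tangle

/-- The tangle that consists of one crossing. -/
def crossing (ε : ℤˣ) : Tangle where
  Crossing := Unit
  finite := inferInstance
  sign _ := ε
  tip i := ((), i)
  glue h := Sum.inr h.2
  glue_tip _ := rfl
  tip_of_glue := by rintro ⟨⟨⟩, j⟩ i h; simpa using h
  glue_glue := by intro h h' hh; simp at hh
  glue_ne := by intro h; simp

/-- The inclusion of the half-edges of the first of two tangles into those of their union. -/
def inLeft {X Y : Type} (h : X × Fin 4) : (X ⊕ Y) × Fin 4 := (Sum.inl h.1, h.2)

/-- The inclusion of the half-edges of the second of two tangles into those of their union. -/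
def inRight {X Y : Type} (h : Y × Fin 4) : (X ⊕ Y) × Fin 4 := (Sum.inr h.1, h.2)

/-- The sum: `B` is placed to the right of `A`, and NE, SE of `A` are joined to NW, SW of `B`. -/
def sum (A B : Tangle) : Tangle where
  Crossing := A.Crossing ⊕ B.Crossing
  finite := have := A.finite; have := B.finite; inferInstance
  sign := Sum.elim A.sign B.sign
  tip := ![inRight (B.tip 0), inLeft (A.tip 1), inLeft (A.tip 2), inRight (B.tip 3)]
  glue h := match h with
    | (Sum.inl x, i) => match A.glue (x, i) with
      | Sum.inl h' => Sum.inl (inLeft h')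
      | Sum.inr 0 => Sum.inl (inRight (B.tip 1))
      | Sum.inr 1 => Sum.inr 1
      | Sum.inr 2 => Sum.inr 2
      | Sum.inr 3 => Sum.inl (inRight (B.tip 2))
    | (Sum.inr y, i) => match B.glue (y, i) with
      | Sum.inl h' => Sum.inl (inRight h')
      | Sum.inr 0 => Sum.inr 0
      | Sum.inr 1 => Sum.inl (inLeft (A.tip 0))
      | Sum.inr 2 => Sum.inl (inLeft (A.tip 3))
      | Sum.inr 3 => Sum.inr 3
  glue_tip := by
    intro i
    fin_cases i <;> simp [inLeft, inRight, glue_tip]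
  tip_of_glue := by
    rintro ⟨x | y, i⟩ j h
    · rcases hA : A.glue (x, i) with h' | k
      · simp [hA] at h
      · have := A.tip_of_glue _ _ hA
        fin_cases k <;> simp [hA] at h <;> subst h <;> simp [inLeft] <;>
          exact ⟨congrArg Prod.fst this, congrArg Prod.snd this⟩
    · rcases hB : B.glue (y, i) with h' | k
      · simp [hB] at h
      · have := B.tip_of_glue _ _ hB
        fin_cases k <;> simp [hB] at h <;> subst h <;> simp [inRight] <;>
          exact ⟨congrArg Prod.fst this, congrArg Prod.snd this⟩
  glue_glue := by
    rintro ⟨x | y, i⟩ h' h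
    · rcases hA : A.glue (x, i) with h'' | k
      · have := A.glue_glue _ _ hA
        simp [hA] at h; subst h; simp [inLeft, this]
      · have := A.tip_of_glue _ _ hA
        fin_cases k <;> simp [hA] at h <;> subst h <;> simp [inLeft, inRight, glue_tip] <;>
          exact ⟨(congrArg Prod.fst this).symm, (congrArg Prod.snd this).symm⟩
    · rcases hB : B.glue (y, i) with h'' | k
      · have := B.glue_glue _ _ hB
        simp [hB] at h; subst h; simp [inRight, this]
      · have := B.tip_of_glue _ _ hB
        fin_cases k <;> simp [hB] at h <;> subst h <;> simp [inLeft, inRight, glue_tip] <;>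
          exact ⟨(congrArg Prod.fst this).symm, (congrArg Prod.snd this).symm⟩
  glue_ne := by
    rintro ⟨x | y, i⟩ h
    · rcases hA : A.glue (x, i) with h'' | k
      · have := A.glue_ne (x, i)
        simp [hA, inLeft, Prod.ext_iff] at h this; tauto
      · fin_cases k <;> simp [hA, inRight] at h
    · rcases hB : B.glue (y, i) with h'' | k
      · have := B.glue_ne (y, i)
        simp [hB, inRight, Prod.ext_iff] at h this; tauto
      · fin_cases k <;> simp [hB, inLeft] at h

/-- The product: `A` is placed on top of `B`, and SE, SW of `A` are joined to NE, NW of `B`. -/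
def prod (A B : Tangle) : Tangle where
  Crossing := A.Crossing ⊕ B.Crossing
  finite := have := A.finite; have := B.finite; inferInstance
  sign := Sum.elim A.sign B.sign
  tip := ![inLeft (A.tip 0), inLeft (A.tip 1), inRight (B.tip 2), inRight (B.tip 3)]
  glue h := match h with
    | (Sum.inl x, i) => match A.glue (x, i) with
      | Sum.inl h' => Sum.inl (inLeft h')
      | Sum.inr 0 => Sum.inr 0
      | Sum.inr 1 => Sum.inr 1
      | Sum.inr 2 => Sum.inl (inRight (B.tip 1))
      | Sum.inr 3 => Sum.inl (inRight (B.tip 0))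
    | (Sum.inr y, i) => match B.glue (y, i) with
      | Sum.inl h' => Sum.inl (inRight h')
      | Sum.inr 0 => Sum.inl (inLeft (A.tip 3))
      | Sum.inr 1 => Sum.inl (inLeft (A.tip 2))
      | Sum.inr 2 => Sum.inr 2
      | Sum.inr 3 => Sum.inr 3
  glue_tip := by
    intro i
    fin_cases i <;> simp [inLeft, inRight, glue_tip]
  tip_of_glue := by
    rintro ⟨x | y, i⟩ j h
    · rcases hA : A.glue (x, i) with h' | k
      · simp [hA] at h
      · have := A.tip_of_glue _ _ hA
        fin_cases k <;> simp [hA] at h <;> subst h <;> simp [inLeft] <;>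
          exact ⟨congrArg Prod.fst this, congrArg Prod.snd this⟩
    · rcases hB : B.glue (y, i) with h' | k
      · simp [hB] at h
      · have := B.tip_of_glue _ _ hB
        fin_cases k <;> simp [hB] at h <;> subst h <;> simp [inRight] <;>
          exact ⟨congrArg Prod.fst this, congrArg Prod.snd this⟩
  glue_glue := by
    rintro ⟨x | y, i⟩ h' h
    · rcases hA : A.glue (x, i) with h'' | k
      · have := A.glue_glue _ _ hA
        simp [hA] at h; subst h; simp [inLeft, this]
      · have := A.tip_of_glue _ _ hA
        fin_cases k <;> simp [hA] at h <;> subst h <;> simp [inLeft, inRight, glue_tip] <;>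
          exact ⟨(congrArg Prod.fst this).symm, (congrArg Prod.snd this).symm⟩
    · rcases hB : B.glue (y, i) with h'' | k
      · have := B.glue_glue _ _ hB
        simp [hB] at h; subst h; simp [inRight, this]
      · have := B.tip_of_glue _ _ hB
        fin_cases k <;> simp [hB] at h <;> subst h <;> simp [inLeft, inRight, glue_tip] <;>
          exact ⟨(congrArg Prod.fst this).symm, (congrArg Prod.snd this).symm⟩
  glue_ne := by
    rintro ⟨x | y, i⟩ h
    · rcases hA : A.glue (x, i) with h'' | k
      · have := A.glue_ne (x, i)
        simp [hA, inLeft, Prod.ext_iff] at h this; tauto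
      · fin_cases k <;> simp [hA, inRight] at h
    · rcases hB : B.glue (y, i) with h'' | k
      · have := B.glue_ne (y, i)
        simp [hB, inRight, Prod.ext_iff] at h this; tauto
      · fin_cases k <;> simp [hB, inLeft] at h

/-- A horizontal row of `n + 1` crossings of sign `ε`. -/
def row (ε : ℤˣ) : ℕ → Tangle
  | 0 => crossing ε
  | n + 1 => sum (row ε n) (crossing ε)

/-- A vertical column of `n + 1` crossings of sign `ε`. -/
def column (ε : ℤˣ) : ℕ → Tangle
  | 0 => crossing ε
  | n + 1 => prod (column ε n) (crossing ε)

/-- The standard diagram of the rational tangle of a continued fraction whose denominators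
`ε a, ε b, …` have the same sign `ε`. The numbers `a, b, …` are listed here from the outermost box of
twists to the innermost one. The boxes are vertical and horizontal in turn, vertical ones being
attached below and horizontal ones on the right; `vertical` says which of the two the outermost box
is. Drawn in this way all the crossings have sign `ε`: the diagram is alternating. -/
def rational (ε : ℤˣ) : (vertical : Bool) → ℕ+ → List ℕ+ → Tangle
  | true, a, [] => column ε a.natPred
  | false, a, [] => row ε a.natPred
  | true, a, b :: l => prod (rational ε false b l) (column ε a.natPred)
  | false, a, b :: l => sum (rational ε true b l) (row ε a.natPred)

/-- The orientations of a tangle. -/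
structure Orientation (T : Tangle) where
  out : T.Crossing × Fin 4 → Bool
  out_opposite : ∀ x i, out (x, i + 2) = !out (x, i)
  out_glue : ∀ h h', T.glue h = Sum.inl h' → out h' = !out h

end Tangle

/-- Blocks: expressions built from rational tangles (with denominators of one sign) by sums and
products. -/
inductive RationalBlock : Type
  | rational (ε : ℤˣ) (vertical : Bool) (a : ℕ+) (l : List ℕ+)
  | sum (b b' : RationalBlock)
  | prod (b b' : RationalBlock)

namespace RationalBlock

/-- The tangle diagram of a block. -/
def tangle : RationalBlock → Tangle
  | rational ε v a l => Tangle.rational ε v a l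
  | sum b b' => Tangle.sum b.tangle b'.tangle
  | prod b b' => Tangle.prod b.tangle b'.tangle

/-- The block extends a crossing of sign `s`: the denominators of each rational tangle in it have
the sign `s`. -/
def Extends (s : ℤˣ) : RationalBlock → Prop
  | rational ε _ _ _ => ε = s
  | sum b b' => b.Extends s ∧ b'.Extends s
  | prod b b' => b.Extends s ∧ b'.Extends s

end RationalBlock

/-! ### Replacing a crossing by a tangle -/

namespace Diagram

/-- The half-edges of a diagram seen from outside after the crossing `c` is replaced by `T`: the
half-edges of `c` become those at the corresponding ends of `T`. -/
noncomputable def port (D : Diagram) (c : D.Crossing) (T : Tangle) (h : D.Crossing × Fin 4) :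
    ({x // x ≠ c} ⊕ T.Crossing) × Fin 4 :=
  open Classical in
  if hx : h.1 = c then Tangle.inRight (T.tip h.2) else (Sum.inl ⟨h.1, hx⟩, h.2)

/-- The diagram obtained by replacing the crossing `c` by the tangle `T`, in the square in which `c`
is drawn. -/
noncomputable def replace (D : Diagram) (c : D.Crossing) (T : Tangle) : Diagram where
  Crossing := {x // x ≠ c} ⊕ T.Crossing
  finite := have := D.finite; have := T.finite; inferInstance
  sign := Sum.elim (fun x => D.sign x.1) T.sign
  glue h := match h with
    | (Sum.inl x, i) => D.port c T (D.glue (x.1, i))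
    | (Sum.inr y, i) => match T.glue (y, i) with
      | Sum.inl h' => Tangle.inRight h'
      | Sum.inr j => D.port c T (D.glue (c, j))
  glue_glue := by
    have key : ∀ h h' : D.Crossing × Fin 4, D.glue h = h' →
        (match D.port c T h' with
          | (Sum.inl x, i) => D.port c T (D.glue (x.1, i))
          | (Sum.inr y, i) => match T.glue (y, i) with
            | Sum.inl h' => Tangle.inRight h'
            | Sum.inr j => D.port c T (D.glue (c, j))) = D.port c T h := by
      rintro h ⟨x, i⟩ hh
      have h2 := D.glue_glue h
      rw [hh] at h2
      by_cases hx : x = c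
      · subst hx
        rw [show D.port x T (x, i) = (Sum.inr (T.tip i).1, (T.tip i).2) by
          simp [port, Tangle.inRight]]
        simp [T.glue_tip, h2]
      · rw [show D.port c T (x, i) = (Sum.inl ⟨x, hx⟩, i) by simp [port, hx]]
        simp [h2]
    rintro ⟨⟨x, hx⟩ | y, i⟩
    · refine (key (x, i) _ rfl).trans ?_
      simp [port, hx]
    · rcases hT : T.glue (y, i) with h' | j
      · simp [hT, Tangle.inRight, T.glue_glue _ _ hT]
      · simp only [hT]
        refine (key (c, j) _ rfl).trans ?_
        simp [port, Tangle.inRight, ← T.tip_of_glue _ _ hT]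
  glue_ne := by
    have inj : ∀ h h', D.port c T h = D.port c T h' → h = h' := by
      rintro ⟨x, i⟩ ⟨x', i'⟩ hh
      by_cases hx : x = c <;> by_cases hx' : x' = c <;>
        simp [port, hx, hx', Tangle.inRight, Prod.ext_iff] at hh
      · have h1 := T.glue_tip i
        rw [show T.tip i = T.tip i' from Prod.ext hh.1 hh.2, T.glue_tip] at h1
        rw [hx, hx', Sum.inr.inj h1]
      · exact Prod.ext hh.1 hh.2
    rintro ⟨⟨x, hx⟩ | y, i⟩ h
    · refine D.glue_ne (x, i) (inj _ _ (h.trans ?_))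
      simp [port, hx]
    · rcases hT : T.glue (y, i) with h' | j
      · have := T.glue_ne (y, i)
        simp [hT, Tangle.inRight, Prod.ext_iff] at h this
        tauto
      · simp only [hT] at h
        refine D.glue_ne (c, j) (inj _ _ (h.trans ?_))
        simp [port, Tangle.inRight, ← T.tip_of_glue _ _ hT]
  circles := D.circles

end Diagram

namespace OrientedDiagram

/-- The oriented diagram obtained by replacing the oriented crossing `c` by an oriented tangle whose
orientation agrees with that of `c` at the four corners. -/
noncomputable def replace (D : OrientedDiagram) (c : D.Crossing) (T : Tangle) (o : T.Orientation)
    (ho : ∀ i, o.out (T.tip i) = D.out (c, i)) : OrientedDiagram where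
  toDiagram := D.toDiagram.replace c T
  out h := match h with
    | (Sum.inl x, i) => D.out (x.1, i)
    | (Sum.inr y, i) => o.out (y, i)
  out_opposite := by
    rintro (x | y) i
    · exact D.out_opposite x.1 i
    · exact o.out_opposite y i
  out_glue := by
    have key : ∀ h : D.Crossing × Fin 4,
        (match D.toDiagram.port c T h with
          | (Sum.inl x, i) => D.out (x.1, i)
          | (Sum.inr y, i) => o.out (y, i)) = D.out h := by
      rintro ⟨x, i⟩
      by_cases hx : x = c
      · subst hx
        simpa [Diagram.port, Tangle.inRight] using ho i
      · simp [Diagram.port, hx]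
    rintro ⟨x | y, i⟩
    · exact (key _).trans (D.out_glue _)
    · rcases hT : T.glue (y, i) with h' | j
      · simpa [Diagram.replace, hT, Tangle.inRight] using o.out_glue _ _ hT
      · simp only [Diagram.replace, hT]
        refine (key _).trans ((D.out_glue _).trans ?_)
        rw [← ho j, ← T.tip_of_glue _ _ hT]

end OrientedDiagram

/-! Homogeneity is turned into a linear condition. A two-colouring of the edges of a finite
multigraph is constant on every block exactly when each integral vertex potential can be modified so
that its differences survive on one colour and vanish on the other (`splitsAlong_iff_blocks`). For
Seifert graphs such a potential is a function on half-edges that is constant along Seifert circles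
(`isHomogeneous_iff`), and this formulation is local enough to be cut along the boundary of a
tangle.

Let all crossings of the tangle have sign `ε`. Then a crossing has type `ε` if and only if its
strands run both up or both down, that is, its Seifert smoothing joins NE to SE and NW to SW;
otherwise it has type `-ε` and the smoothing joins NE to NW and SE to SW. By induction over sums and
products, every oriented tangle built from such crossings behaves like one of these two
(`IsAlternating.isVertical_or_isHorizontal`). A vertical tangle joins its ends by Seifert arcs as a
crossing of type `ε` does and has a splitting that keeps all end values; a horizontal tangle joins
them as a crossing of type `-ε` does and has a splitting with all end values equal. The orientation
at the corners forces the tangle to be of the kind of `c`. Hence a potential of the new diagram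
induces one of `D`, that one splits because `D` is homogeneous, and the result extends over the
tangle. Types inside the tangle need no further control.

Planarity is a count. The tangle is connected and, if it has `n + 1` crossings, it has `n` inner
faces, so `V` and `F` both grow by `n` while `C` is unchanged. Faces and components are counted
through the `2 ^ k` Boolean functions on a set of `k` elements: functions on a quotient are
compatible functions on half-edges, and these can be restricted and glued. -/

/-! ### Blocks and splittings of potentials -/

namespace Graph

open Set

variable {α β : Type*} {G H K : Graph α β} {R : Set β}

/-- Every integral potential `f` can be replaced by one that has the same differences along the
edges in `R` and is constant along the other edges. Equivalently, the cycle matroid is the direct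
sum of its restrictions to `R` and to the complement of `R`. -/
def SplitsAlong (G : Graph α β) (R : Set β) : Prop :=
  ∀ f : α → ℤ, ∃ h : α → ℤ, ∀ e x y, G.IsLink e x y →
    (e ∈ R → h x - h y = f x - f y) ∧ (e ∉ R → h x = h y)

theorem SplitsAlong.mono (hG : G.SplitsAlong R) (hH : H ≤ G) : H.SplitsAlong R := by
  intro f
  obtain ⟨h, hh⟩ := hG f
  exact ⟨h, fun e x y he => hh e x y (he.mono hH)⟩

/-- Splittings of two subgraphs with at most one common vertex are glued. -/
theorem SplitsAlong.union (hH : H.SplitsAlong R) (hK : K.SplitsAlong R)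
    (hG : ∀ e x y, G.IsLink e x y → H.IsLink e x y ∨ K.IsLink e x y) (v : α)
    (hv : H.vertexSet ∩ K.vertexSet ⊆ {v}) : G.SplitsAlong R := by
  classical
  intro f
  obtain ⟨h, hh⟩ := hH f
  obtain ⟨k, hk⟩ := hK f
  -- Both potentials are shifted to vanish at `v`, the only vertex where they could disagree.
  let g : α → ℤ := fun x => if x ∈ H.vertexSet then h x - h v else k x - k v
  have gH : ∀ x ∈ H.vertexSet, g x = h x - h v := fun x hx => if_pos hx
  have gK : ∀ x ∈ K.vertexSet, g x = k x - k v := by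
    intro x hx
    by_cases hxH : x ∈ H.vertexSet
    · obtain rfl : x = v := hv ⟨hxH, hx⟩
      rw [gH x hxH, sub_self, sub_self]
    · exact if_neg hxH
  refine ⟨g, fun e x y he => ?_⟩
  rcases hG e x y he with he | he
  · rw [gH x he.left_mem, gH y he.right_mem]
    have := hh e x y he
    exact ⟨fun h => by linarith [this.1 h], fun h => by linarith [this.2 h]⟩
  · rw [gK x he.left_mem, gK y he.right_mem]
    have := hk e x y he
    exact ⟨fun h => by linarith [this.1 h], fun h => by linarith [this.2 h]⟩

instance instFinite [Finite α] [Finite β] : Finite (Graph α β) := by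
  refine Finite.of_injective
    (fun G : Graph α β => (G.vertexSet, fun (e : β) (x y : α) => G.IsLink e x y)) ?_
  intro G H h
  rw [Prod.mk.injEq] at h
  exact Graph.ext h.1 fun e x y => by simpa using congrFun (congrFun (congrFun h.2 e) x) y

theorem exists_isBlock_ge [Finite α] [Finite β] (hH : H ≤ G) (hc : H.IsConnected)
    (hcut : ∀ v, ¬ H.IsCutVertex v) : ∃ B, G.IsBlock B ∧ H ≤ B := by
  obtain ⟨B, hB, hm⟩ := (Set.toFinite {H : Graph α β | H ≤ G ∧ H.IsConnected ∧
    ∀ v, ¬ H.IsCutVertex v}).exists_le_maximal ⟨hH, hc, hcut⟩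
  exact ⟨B, hm, hB⟩

/-- With all edges in `R` the potential itself serves; with none, the zero potential. -/
theorem splitsAlong_of_monochromatic
    (hE : ∀ e ∈ G.edgeSet, ∀ e' ∈ G.edgeSet, (e ∈ R ↔ e' ∈ R)) : G.SplitsAlong R := by
  intro f
  by_cases hR : ∃ e ∈ G.edgeSet, e ∈ R
  · obtain ⟨e₀, he₀, hR⟩ := hR
    exact ⟨f, fun e x y he => ⟨fun _ => rfl, fun h => absurd ((hE _ he₀ _ he.edge_mem).1 hR) h⟩⟩
  · exact ⟨0, fun e x y he => ⟨fun h => absurd ⟨e, he.edge_mem, h⟩ hR, fun _ => rfl⟩⟩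

/-- A graph with a vertex is connected or a disjoint union of two proper subgraphs. -/
theorem exists_disjoint_of_not_isConnected (hG : ¬ G.IsConnected) (hne : G.vertexSet.Nonempty) :
    ∃ H K : Graph α β, H ≤ G ∧ K ≤ G ∧ H.vertexSet ≠ G.vertexSet ∧ K.vertexSet ≠ G.vertexSet ∧
      Disjoint H.vertexSet K.vertexSet ∧
      ∀ e x y, G.IsLink e x y → H.IsLink e x y ∨ K.IsLink e x y := by
  have : ∃ x ∈ G.vertexSet, ∃ y ∈ G.vertexSet, ¬ Relation.ReflTransGen G.Adj x y := by
    by_contra! h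
    exact hG ⟨hne, h⟩
  obtain ⟨a, ha, b, hb, hab⟩ := this
  let S : Set α := {x | x ∈ G.vertexSet ∧ Relation.ReflTransGen G.Adj a x}
  let T : Set α := {x | x ∈ G.vertexSet ∧ ¬ Relation.ReflTransGen G.Adj a x}
  refine ⟨G.induce S, G.induce T, induce_le fun x hx => hx.1, induce_le fun x hx => hx.1,
    fun h => ?_, fun h => ?_, ?_, fun e x y he => ?_⟩
  · have : b ∈ S := by rw [← h] at hb; exact hb
    exact hab this.2
  · have : a ∈ T := by rw [← h] at ha; exact ha
    exact this.2 .refl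
  · exact Set.disjoint_left.2 fun x hx hx' => hx'.2 hx.2
  · by_cases hx : Relation.ReflTransGen G.Adj a x
    · exact Or.inl ⟨he, ⟨he.left_mem, hx⟩, he.right_mem, hx.tail ⟨e, he⟩⟩
    · exact Or.inr ⟨he, ⟨he.left_mem, hx⟩, he.right_mem, fun hy => hx (hy.tail ⟨e, he.symm⟩)⟩

/-- Cutting at cut vertices and between components leaves pieces that lie inside blocks, hence are
monochromatic; their splittings glue because the pieces share at most one vertex. -/
theorem splitsAlong_of_blocks [Finite α] [Finite β]
    (hG : ∀ B, G.IsBlock B → ∀ e ∈ B.edgeSet, ∀ e' ∈ B.edgeSet, (e ∈ R ↔ e' ∈ R)) :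
    G.SplitsAlong R := by
  -- The size counts vertices and edges together: a cut at a vertex loses edges, a separation into
  -- components loses vertices.
  suffices h : ∀ n : ℕ, ∀ H ≤ G, H.vertexSet.ncard + H.edgeSet.ncard = n → H.SplitsAlong R from
    h _ G le_rfl rfl
  intro n
  induction n using Nat.strong_induction_on with
  | _ n ih =>
  intro H hH hn
  subst hn
  by_cases hcut : ∃ v, H.IsCutVertex v
  · obtain ⟨v, A, B, hA, hB, -, hE, hdisj, hAne, hBne, hv⟩ := hcut
    have small : ∀ {A B : Graph α β}, A ≤ H → B ≤ H → Disjoint A.edgeSet B.edgeSet →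
        B.edgeSet.Nonempty →
        A.vertexSet.ncard + A.edgeSet.ncard < H.vertexSet.ncard + H.edgeSet.ncard := by
      intro A B hA hB hd ⟨e, he⟩
      refine add_lt_add_of_le_of_lt (ncard_le_ncard hA.vertexSet_mono) (ncard_lt_ncard ?_)
      exact ⟨hA.edgeSet_mono, fun h => disjoint_left.1 hd (h (hB.edgeSet_mono he)) he⟩
    refine (ih _ (small hA hB hdisj hBne) A (hA.trans hH) rfl).union
      (ih _ (small hB hA hdisj.symm hAne) B (hB.trans hH) rfl) (fun e x y he => ?_) v hv.subset
    rcases (hE ▸ he.edge_mem : e ∈ A.edgeSet ∪ B.edgeSet) with h | h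
    · exact Or.inl ((IsSubgraph.isLink_iff hA h).2 he)
    · exact Or.inr ((IsSubgraph.isLink_iff hB h).2 he)
  · push Not at hcut
    by_cases hc : H.IsConnected
    · obtain ⟨B, hB, hHB⟩ := exists_isBlock_ge hH hc hcut
      exact splitsAlong_of_monochromatic fun e he e' he' =>
        hG B hB e (hHB.edgeSet_mono he) e' (hHB.edgeSet_mono he')
    · rcases H.vertexSet.eq_empty_or_nonempty with he | hne
      · exact fun f => ⟨f, fun e x y hl => absurd hl.left_mem (by simp [he])⟩
      · obtain ⟨A, B, hA, hB, hA', hB', hd, hl⟩ := exists_disjoint_of_not_isConnected hc hne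
        have small : ∀ {A : Graph α β}, A ≤ H → A.vertexSet ≠ H.vertexSet →
            A.vertexSet.ncard + A.edgeSet.ncard < H.vertexSet.ncard + H.edgeSet.ncard :=
          fun hA hne => add_lt_add_of_lt_of_le
            (ncard_lt_ncard (hA.vertexSet_mono.ssubset_of_ne hne)) (ncard_le_ncard hA.edgeSet_mono)
        obtain ⟨v, -⟩ := hne
        exact (ih _ (small hA hA') A (hA.trans hH) rfl).union
          (ih _ (small hB hB') B (hB.trans hH) rfl) hl v (by simp [hd.inter_eq])

/-! ### Cut vertices from splittings of potentials -/

/-- A vertex `v` is a cut vertex if the edges fall into two nonempty classes `F` and its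
complement, and the vertices other than `v` into those that meet only edges in `F` and those that
meet no edge in `F`. -/
theorem isCutVertex_of_edgeSet {v : α} {S : Set α} {F : Set β} (hv : v ∈ G.vertexSet)
    (hvS : v ∉ S) (hF : (G.edgeSet ∩ F).Nonempty) (hF' : (G.edgeSet \ F).Nonempty)
    (h : ∀ e x y, G.IsLink e x y → e ∈ F → x = v ∨ x ∈ S)
    (h' : ∀ e x y, G.IsLink e x y → e ∉ F → x ∉ S) : G.IsCutVertex v := by
  let A := (G.restrict F).induce (insert v (S ∩ G.vertexSet))
  let B := (G.restrict Fᶜ).induce (G.vertexSet \ S)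
  have hA : A ≤ G := by
    refine le_trans (induce_le ?_) restrict_le
    exact insert_subset hv inter_subset_right
  have hB : B ≤ G := le_trans (induce_le sdiff_subset) restrict_le
  have hAE : A.edgeSet = G.edgeSet ∩ F := by
    ext e
    constructor
    · intro he
      obtain ⟨x, y, hl⟩ := exists_isLink_of_mem_edgeSet he
      exact ⟨hA.edgeSet_mono he, hl.1.1⟩
    · rintro ⟨he, heF⟩
      obtain ⟨x, y, hl⟩ := exists_isLink_of_mem_edgeSet he
      have hm : ∀ {x y}, G.IsLink e x y → x ∈ insert v (S ∩ G.vertexSet) := fun hl =>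
        (h e _ _ hl heF).imp id fun h => ⟨h, hl.left_mem⟩
      exact IsLink.edge_mem (G := A) ⟨⟨heF, hl⟩, hm hl, hm hl.symm⟩
  have hBE : B.edgeSet = G.edgeSet \ F := by
    ext e
    constructor
    · intro he
      obtain ⟨x, y, hl⟩ := exists_isLink_of_mem_edgeSet he
      exact ⟨hB.edgeSet_mono he, hl.1.1⟩
    · rintro ⟨he, heF⟩
      obtain ⟨x, y, hl⟩ := exists_isLink_of_mem_edgeSet he
      exact IsLink.edge_mem (G := B)
        ⟨⟨heF, hl⟩, ⟨hl.left_mem, h' e _ _ hl heF⟩, ⟨hl.right_mem, h' e _ _ hl.symm heF⟩⟩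
  refine ⟨A, B, hA, hB, ?_, ?_, ?_, hAE ▸ hF, hBE ▸ hF', ?_⟩
  · ext x
    change (x = v ∨ x ∈ S ∧ x ∈ G.vertexSet) ∨ (x ∈ G.vertexSet ∧ x ∉ S) ↔ _
    constructor
    · rintro ((rfl | h) | h)
      exacts [hv, h.2, h.1]
    · tauto
  · rw [hAE, hBE, inter_union_sdiff]
  · rw [hAE, hBE]
    exact disjoint_left.2 fun e he he' => he'.2 he.2
  · ext x
    change (x = v ∨ x ∈ S ∧ x ∈ G.vertexSet) ∧ (x ∈ G.vertexSet ∧ x ∉ S) ↔ x = v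
    constructor
    · tauto
    · rintro rfl
      exact ⟨Or.inl rfl, hv, hvS⟩

theorem isCutVertex_of_loop {v : α} {e e' : β} (he : G.IsLink e v v) (he' : e' ∈ G.edgeSet)
    (hne : e' ≠ e) : G.IsCutVertex v :=
  isCutVertex_of_edgeSet (S := ∅) (F := {e}) he.left_mem (notMem_empty v)
    ⟨e, he.edge_mem, rfl⟩ ⟨e', he', hne⟩
    (by rintro _ x y hl rfl; exact Or.inl ((hl.left_eq_or_eq he).elim id id))
    (fun _ _ _ _ _ => notMem_empty _)

/-- A vertex at which an edge in `R` and an edge outside `R` meet is a cut vertex, if potentials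
split along `R`. -/
theorem SplitsAlong.exists_isCutVertex (hG : G.SplitsAlong R) {v a b : α} {e e' : β}
    (he : G.IsLink e v a) (he' : G.IsLink e' v b) (heR : e ∈ R) (heR' : e' ∉ R) :
    G.IsCutVertex v := by
  classical
  have hne : e' ≠ e := fun h => heR' (h ▸ heR)
  -- A loop has difference zero for every potential, so it would escape the argument below.
  by_cases hav : a = v
  · subst hav
    exact isCutVertex_of_loop he he'.edge_mem hne
  -- The indicator of `v` varies only along edges at `v`, so its splitting `h` is constant on each
  -- component of the graph without `v`. It differs from `h v` at `a` but not at `b`, so the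
  -- vertices where `h` differs from `h v` form the side to be cut off.
  obtain ⟨h, hh⟩ := hG (Pi.single v 1)
  have hva := (hh e v a he).1 heR
  have hvb := (hh e' v b he').2 heR'
  rw [Pi.single_eq_same, Pi.single_eq_of_ne hav] at hva
  have hconst : ∀ e x y, G.IsLink e x y → x ≠ v → y ≠ v → h x = h y := by
    intro e x y hl hx hy
    by_cases hR : e ∈ R
    · have := (hh e x y hl).1 hR
      rw [Pi.single_eq_of_ne hx, Pi.single_eq_of_ne hy] at this
      linarith
    · exact (hh e x y hl).2 hR
  refine isCutVertex_of_edgeSet (S := {x | h x ≠ h v})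
    (F := {e | ∃ x y, G.IsLink e x y ∧ h x ≠ h v}) he.left_mem (fun h => h rfl)
    ⟨e, he.edge_mem, a, v, he.symm, ?_⟩ ⟨e', he'.edge_mem, ?_⟩ ?_ ?_
  · intro h
    linarith
  · rintro ⟨x, y, hl, hx⟩
    rcases hl.left_eq_or_eq he' with rfl | rfl
    · exact hx rfl
    · exact hx hvb.symm
  · rintro e x y hl ⟨x', y', hl', hx'⟩
    rcases hl'.left_eq_or_eq hl with rfl | rfl
    · exact Or.inr hx'
    · by_cases hx : x = v
      · exact Or.inl hx
      · right
        have hy : x' ≠ v := fun h' => hx' (h' ▸ rfl)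
        change h x ≠ h v
        rwa [hconst e x x' hl hx hy]
  · exact fun e x y hl hF hx => hF ⟨x, y, hl, hx⟩

/-- Along a walk from an edge in `R` to one outside, some vertex would meet edges of both kinds and
hence be a cut vertex. -/
theorem SplitsAlong.mem_iff_mem (hG : G.SplitsAlong R) (hc : G.IsConnected)
    (hcut : ∀ v, ¬ G.IsCutVertex v) {e e' : β} (he : e ∈ G.edgeSet) (he' : e' ∈ G.edgeSet)
    (heR : e ∈ R) : e' ∈ R := by
  by_contra heR'
  obtain ⟨x, y, hl⟩ := exists_isLink_of_mem_edgeSet he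
  obtain ⟨x', y', hl'⟩ := exists_isLink_of_mem_edgeSet he'
  have key : ∀ z, Relation.ReflTransGen G.Adj x z → ∃ e w, G.IsLink e z w ∧ e ∈ R := by
    intro z hz
    induction hz with
    | refl => exact ⟨e, y, hl, heR⟩
    | tail _ h ih =>
      obtain ⟨e₁, w, hw, hR⟩ := ih
      obtain ⟨e₂, he₂⟩ := h
      by_cases h2 : e₂ ∈ R
      · exact ⟨e₂, _, he₂.symm, h2⟩
      · exact absurd (hG.exists_isCutVertex hw he₂ hR h2) (hcut _)
  obtain ⟨e₁, w, hw, hR⟩ := key x' (hc.2 x hl.left_mem x' hl'.left_mem)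
  exact hcut _ (hG.exists_isCutVertex hw hl' hR heR')

/-- Potentials split along `R` if and only if each block has all its edges in `R` or none. -/
theorem splitsAlong_iff_blocks [Finite α] [Finite β] : G.SplitsAlong R ↔
    ∀ B, G.IsBlock B → ∀ e ∈ B.edgeSet, ∀ e' ∈ B.edgeSet, (e ∈ R ↔ e' ∈ R) := by
  refine ⟨fun hG B hB e he e' he' => ?_, splitsAlong_of_blocks⟩
  have hB' := hG.mono hB.prop.1
  exact ⟨hB'.mem_iff_mem hB.prop.2.1 hB.prop.2.2 he he',
    hB'.mem_iff_mem hB.prop.2.1 hB.prop.2.2 he' he⟩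

end Graph

/-! ### Alternating tangles -/

namespace Tangle

/-- The tangles that are built from crossings of sign `ε` by sums and products. -/
inductive IsAlternating (ε : ℤˣ) : Tangle → Prop
  | crossing : IsAlternating ε (crossing ε)
  | sum {A B : Tangle} : IsAlternating ε A → IsAlternating ε B → IsAlternating ε (sum A B)
  | prod {A B : Tangle} : IsAlternating ε A → IsAlternating ε B → IsAlternating ε (prod A B)

theorem isAlternating_row (ε : ℤˣ) : ∀ n, IsAlternating ε (row ε n)
  | 0 => .crossing
  | n + 1 => .sum (isAlternating_row ε n) .crossing

theorem isAlternating_column (ε : ℤˣ) : ∀ n, IsAlternating ε (column ε n)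
  | 0 => .crossing
  | n + 1 => .prod (isAlternating_column ε n) .crossing

theorem isAlternating_rational (ε : ℤˣ) :
    ∀ (v : Bool) (a : ℕ+) (l : List ℕ+), IsAlternating ε (rational ε v a l)
  | true, _, [] => isAlternating_column ε _
  | false, _, [] => isAlternating_row ε _
  | true, _, b :: l => .prod (isAlternating_rational ε false b l) (isAlternating_column ε _)
  | false, _, b :: l => .sum (isAlternating_rational ε true b l) (isAlternating_row ε _)

theorem _root_.RationalBlock.Extends.isAlternating {ε : ℤˣ} :
    ∀ {b : RationalBlock}, b.Extends ε → b.tangle.IsAlternating ε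
  | .rational _ v a l, h => by
    obtain rfl : _ = ε := h
    exact isAlternating_rational _ v a l
  | .sum _ _, h => .sum h.1.isAlternating h.2.isAlternating
  | .prod _ _, h => .prod h.1.isAlternating h.2.isAlternating

theorem IsAlternating.sign_eq {ε : ℤˣ} {T : Tangle} (hT : T.IsAlternating ε) :
    ∀ x, T.sign x = ε := by
  induction hT with
  | crossing => exact fun _ => rfl
  | sum _ _ hA hB => exact fun x => Sum.casesOn x hA hB
  | prod _ _ hA hB => exact fun x => Sum.casesOn x hA hB

/-- A function on the half-edges of two tangles. -/
def elim {X Y K : Type} (u : X × Fin 4 → K) (v : Y × Fin 4 → K) (h : (X ⊕ Y) × Fin 4) : K :=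
  Sum.elim (fun x => u (x, h.2)) (fun y => v (y, h.2)) h.1

theorem elim_inLeft_inRight {X Y K : Type} (f : (X ⊕ Y) × Fin 4 → K) :
    elim (f ∘ inLeft) (f ∘ inRight) = f := by
  funext h
  rcases h with ⟨x | y, i⟩ <;> rfl

/-- The arcs of a sum are those of the summands and the two arcs between them. -/
theorem forall_glue_sum {A B : Tangle}
    {P : (A.Crossing ⊕ B.Crossing) × Fin 4 → (A.Crossing ⊕ B.Crossing) × Fin 4 → Prop} :
    (∀ h h', (sum A B).glue h = Sum.inl h' → P h h') ↔
      (∀ h h', A.glue h = Sum.inl h' → P (inLeft h) (inLeft h')) ∧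
      (∀ h h', B.glue h = Sum.inl h' → P (inRight h) (inRight h')) ∧
      (P (inLeft (A.tip 0)) (inRight (B.tip 1)) ∧ P (inRight (B.tip 1)) (inLeft (A.tip 0))) ∧
      P (inLeft (A.tip 3)) (inRight (B.tip 2)) ∧ P (inRight (B.tip 2)) (inLeft (A.tip 3)) := by
  constructor
  · intro H
    refine ⟨fun h h' hh => H _ _ ?_, fun h h' hh => H _ _ ?_, ⟨H _ _ ?_, H _ _ ?_⟩,
      H _ _ ?_, H _ _ ?_⟩ <;>
    simp_all [sum, inLeft, inRight, glue_tip]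
  · rintro ⟨HA, HB, ⟨h1, h2⟩, h3, h4⟩ (h : (A.Crossing ⊕ B.Crossing) × Fin 4)
      (h' : (A.Crossing ⊕ B.Crossing) × Fin 4) hh
    rcases h with ⟨x | y, i⟩
    · rcases hA : A.glue (x, i) with k | k
      · simp [sum, hA] at hh
        subst hh
        exact HA _ _ hA
      · change P (inLeft (x, i)) h'
        rw [A.tip_of_glue _ _ hA]
        fin_cases k <;> simp [sum, hA] at hh <;> subst hh <;> assumption
    · rcases hB : B.glue (y, i) with k | k
      · simp [sum, hB] at hh
        subst hh
        exact HB _ _ hB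
      · change P (inRight (y, i)) h'
        rw [B.tip_of_glue _ _ hB]
        fin_cases k <;> simp [sum, hB] at hh <;> subst hh <;> assumption

/-- The arcs of a product are those of the factors and the two arcs between them. -/
theorem forall_glue_prod {A B : Tangle}
    {P : (A.Crossing ⊕ B.Crossing) × Fin 4 → (A.Crossing ⊕ B.Crossing) × Fin 4 → Prop} :
    (∀ h h', (prod A B).glue h = Sum.inl h' → P h h') ↔
      (∀ h h', A.glue h = Sum.inl h' → P (inLeft h) (inLeft h')) ∧
      (∀ h h', B.glue h = Sum.inl h' → P (inRight h) (inRight h')) ∧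
      (P (inLeft (A.tip 2)) (inRight (B.tip 1)) ∧ P (inRight (B.tip 1)) (inLeft (A.tip 2))) ∧
      P (inLeft (A.tip 3)) (inRight (B.tip 0)) ∧ P (inRight (B.tip 0)) (inLeft (A.tip 3)) := by
  constructor
  · intro H
    refine ⟨fun h h' hh => H _ _ ?_, fun h h' hh => H _ _ ?_, ⟨H _ _ ?_, H _ _ ?_⟩,
      H _ _ ?_, H _ _ ?_⟩ <;>
    simp_all [prod, inLeft, inRight, glue_tip]
  · rintro ⟨HA, HB, ⟨h1, h2⟩, h3, h4⟩ (h : (A.Crossing ⊕ B.Crossing) × Fin 4)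
      (h' : (A.Crossing ⊕ B.Crossing) × Fin 4) hh
    rcases h with ⟨x | y, i⟩
    · rcases hA : A.glue (x, i) with k | k
      · simp [prod, hA] at hh
        subst hh
        exact HA _ _ hA
      · change P (inLeft (x, i)) h'
        rw [A.tip_of_glue _ _ hA]
        fin_cases k <;> simp [prod, hA] at hh <;> subst hh <;> assumption
    · rcases hB : B.glue (y, i) with k | k
      · simp [prod, hB] at hh
        subst hh
        exact HB _ _ hB
      · change P (inRight (y, i)) h'
        rw [B.tip_of_glue _ _ hB]
        fin_cases k <;> simp [prod, hB] at hh <;> subst hh <;> assumption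

/-! ### Seifert smoothings of tangles -/

/-- `out` is an orientation of `T`. -/
structure IsOrientation (T : Tangle) (out : T.Crossing × Fin 4 → Bool) : Prop where
  opposite : ∀ x i, out (x, i + 2) = !out (x, i)
  glue : ∀ h h', T.glue h = Sum.inl h' → out h' = !out h

/-- `f` is constant along the Seifert circles and Seifert arcs of `T`. -/
structure IsPotential (T : Tangle) (out : T.Crossing × Fin 4 → Bool)
    (f : T.Crossing × Fin 4 → ℤ) : Prop where
  glue : ∀ h h', T.glue h = Sum.inl h' → f h' = f h
  smooth : ∀ x i, out (x, i + 1) ≠ out (x, i) → f (x, i + 1) = f (x, i)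

/-- `g` has the same differences as `f` at the crossings with both strands upwards or both strands
downwards, and difference `0` at the other crossings. -/
def IsSplitting {X : Type} (out : X × Fin 4 → Bool) (f g : X × Fin 4 → ℤ) : Prop :=
  ∀ x, (out (x, 0) = out (x, 1) → g (x, 0) - g (x, 2) = f (x, 0) - f (x, 2)) ∧
    (out (x, 0) ≠ out (x, 1) → g (x, 0) = g (x, 2))

theorem IsPotential.add_const {T : Tangle} {out : T.Crossing × Fin 4 → Bool}
    {f : T.Crossing × Fin 4 → ℤ} (hf : T.IsPotential out f) (k : ℤ) :
    T.IsPotential out fun h => f h + k :=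
  ⟨fun h h' hh => congrArg (· + k) (hf.glue h h' hh),
    fun x i hi => congrArg (· + k) (hf.smooth x i hi)⟩

theorem IsSplitting.add_const {X : Type} {out : X × Fin 4 → Bool} {f g : X × Fin 4 → ℤ}
    (h : IsSplitting out f g) (k : ℤ) : IsSplitting out f fun h => g h + k :=
  fun x => ⟨fun hx => by linarith [(h x).1 hx], fun hx => by linarith [(h x).2 hx]⟩

theorem IsSplitting.elim {X Y : Type} {out f : _} {u : X × Fin 4 → ℤ} {v : Y × Fin 4 → ℤ}
    (hu : IsSplitting (out ∘ inLeft) (f ∘ inLeft) u)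
    (hv : IsSplitting (out ∘ inRight) (f ∘ inRight) v) : IsSplitting out f (elim u v) :=
  fun x => Sum.casesOn x hu hv

/-- The Seifert arcs join NE to SE and NW to SW, and potentials split with given values on the
arcs. -/
structure IsVertical (T : Tangle) (out : T.Crossing × Fin 4 → Bool) : Prop where
  out_zero_three : out (T.tip 0) ≠ out (T.tip 3)
  out_one_two : out (T.tip 1) ≠ out (T.tip 2)
  zero_three : ∀ f, T.IsPotential out f → f (T.tip 0) = f (T.tip 3)
  one_two : ∀ f, T.IsPotential out f → f (T.tip 1) = f (T.tip 2)
  exists_splitting : ∀ f, T.IsPotential out f → ∃ g, T.IsPotential out g ∧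
    IsSplitting out f g ∧ ∀ i, g (T.tip i) = f (T.tip i)

/-- The Seifert arcs join NE to NW and SE to SW, and potentials split with equal values on the
arcs. -/
structure IsHorizontal (T : Tangle) (out : T.Crossing × Fin 4 → Bool) : Prop where
  out_zero_one : out (T.tip 0) ≠ out (T.tip 1)
  out_two_three : out (T.tip 2) ≠ out (T.tip 3)
  zero_one : ∀ f, T.IsPotential out f → f (T.tip 0) = f (T.tip 1)
  two_three : ∀ f, T.IsPotential out f → f (T.tip 2) = f (T.tip 3)
  exists_splitting : ∀ f, T.IsPotential out f → ∀ k, ∃ g, T.IsPotential out g ∧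
    IsSplitting out f g ∧ ∀ i, g (T.tip i) = k

/-- Only the difference between the two vertical arcs is essential; the common level is free. -/
theorem IsVertical.exists_splitting_add {T : Tangle} {out : T.Crossing × Fin 4 → Bool}
    (hT : T.IsVertical out) {f} (hf : T.IsPotential out f) (k : ℤ) :
    ∃ g, T.IsPotential out g ∧ IsSplitting out f g ∧ ∀ i, g (T.tip i) = f (T.tip i) + k := by
  obtain ⟨g, hg, hs, ht⟩ := hT.exists_splitting f hf
  exact ⟨_, hg.add_const k, hs.add_const k, fun i => congrArg (· + k) (ht i)⟩

section Sum

variable {A B : Tangle} {out : (A.Crossing ⊕ B.Crossing) × Fin 4 → Bool}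

theorem isOrientation_sum (h : (sum A B).IsOrientation out) :
    A.IsOrientation (out ∘ inLeft) ∧ B.IsOrientation (out ∘ inRight) ∧
      out (inRight (B.tip 1)) ≠ out (inLeft (A.tip 0)) ∧
      out (inRight (B.tip 2)) ≠ out (inLeft (A.tip 3)) := by
  obtain ⟨h1, h2⟩ := h
  obtain ⟨hA, hB, ⟨h3, -⟩, h4, -⟩ := forall_glue_sum.1 h2
  exact ⟨⟨fun x i => h1 (Sum.inl x) i, hA⟩, ⟨fun x i => h1 (Sum.inr x) i, hB⟩,
    fun h => Bool.not_ne_self _ (h3.symm.trans h), fun h => Bool.not_ne_self _ (h4.symm.trans h)⟩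

theorem isOrientation_prod (h : (prod A B).IsOrientation out) :
    A.IsOrientation (out ∘ inLeft) ∧ B.IsOrientation (out ∘ inRight) ∧
      out (inRight (B.tip 1)) ≠ out (inLeft (A.tip 2)) ∧
      out (inRight (B.tip 0)) ≠ out (inLeft (A.tip 3)) := by
  obtain ⟨h1, h2⟩ := h
  obtain ⟨hA, hB, ⟨h3, -⟩, h4, -⟩ := forall_glue_prod.1 h2
  exact ⟨⟨fun x i => h1 (Sum.inl x) i, hA⟩, ⟨fun x i => h1 (Sum.inr x) i, hB⟩,
    fun h => Bool.not_ne_self _ (h3.symm.trans h), fun h => Bool.not_ne_self _ (h4.symm.trans h)⟩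

theorem isPotential_sum {f : (A.Crossing ⊕ B.Crossing) × Fin 4 → ℤ} :
    (sum A B).IsPotential out f ↔
      A.IsPotential (out ∘ inLeft) (f ∘ inLeft) ∧ B.IsPotential (out ∘ inRight) (f ∘ inRight) ∧
      f (inRight (B.tip 1)) = f (inLeft (A.tip 0)) ∧
      f (inRight (B.tip 2)) = f (inLeft (A.tip 3)) := by
  constructor
  · rintro ⟨h1, h2⟩
    obtain ⟨hA, hB, ⟨h3, -⟩, h4, -⟩ := forall_glue_sum.1 h1
    exact ⟨⟨hA, fun x i => h2 (Sum.inl x) i⟩, ⟨hB, fun x i => h2 (Sum.inr x) i⟩, h3, h4⟩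
  · rintro ⟨hA, hB, h3, h4⟩
    exact ⟨forall_glue_sum.2 ⟨hA.1, hB.1, ⟨h3, h3.symm⟩, h4, h4.symm⟩,
      fun x => Sum.casesOn x hA.2 hB.2⟩

theorem isPotential_prod {f : (A.Crossing ⊕ B.Crossing) × Fin 4 → ℤ} :
    (prod A B).IsPotential out f ↔
      A.IsPotential (out ∘ inLeft) (f ∘ inLeft) ∧ B.IsPotential (out ∘ inRight) (f ∘ inRight) ∧
      f (inRight (B.tip 1)) = f (inLeft (A.tip 2)) ∧
      f (inRight (B.tip 0)) = f (inLeft (A.tip 3)) := by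
  constructor
  · rintro ⟨h1, h2⟩
    obtain ⟨hA, hB, ⟨h3, -⟩, h4, -⟩ := forall_glue_prod.1 h1
    exact ⟨⟨hA, fun x i => h2 (Sum.inl x) i⟩, ⟨hB, fun x i => h2 (Sum.inr x) i⟩, h3, h4⟩
  · rintro ⟨hA, hB, h3, h4⟩
    exact ⟨forall_glue_prod.2 ⟨hA.1, hB.1, ⟨h3, h3.symm⟩, h4, h4.symm⟩,
      fun x => Sum.casesOn x hA.2 hB.2⟩

/-- Splittings of the summands fit together once their values agree on the two connecting arcs. The
vectors `a` and `b` record the end values, so that the case analysis needs only to choose levels. -/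
theorem exists_splitting_sum {f : (A.Crossing ⊕ B.Crossing) × Fin 4 → ℤ} {a b : Fin 4 → ℤ}
    (hA : ∃ g, A.IsPotential (out ∘ inLeft) g ∧ IsSplitting (out ∘ inLeft) (f ∘ inLeft) g ∧
      ∀ i, g (A.tip i) = a i)
    (hB : ∃ g, B.IsPotential (out ∘ inRight) g ∧ IsSplitting (out ∘ inRight) (f ∘ inRight) g ∧
      ∀ i, g (B.tip i) = b i)
    (h1 : b 1 = a 0) (h2 : b 2 = a 3) :
    ∃ g, (sum A B).IsPotential out g ∧ IsSplitting out f g ∧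
      ∀ i, g ((sum A B).tip i) = ![b 0, a 1, a 2, b 3] i := by
  obtain ⟨u, hu, hus, hut⟩ := hA
  obtain ⟨v, hv, hvs, hvt⟩ := hB
  refine ⟨elim u v, isPotential_sum.2 ⟨hu, hv, ?_, ?_⟩, hus.elim hvs, fun i => ?_⟩
  · exact (hvt 1).trans (h1.trans (hut 0).symm)
  · exact (hvt 2).trans (h2.trans (hut 3).symm)
  · fin_cases i
    exacts [hvt 0, hut 1, hut 2, hvt 3]

theorem exists_splitting_prod {f : (A.Crossing ⊕ B.Crossing) × Fin 4 → ℤ} {a b : Fin 4 → ℤ}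
    (hA : ∃ g, A.IsPotential (out ∘ inLeft) g ∧ IsSplitting (out ∘ inLeft) (f ∘ inLeft) g ∧
      ∀ i, g (A.tip i) = a i)
    (hB : ∃ g, B.IsPotential (out ∘ inRight) g ∧ IsSplitting (out ∘ inRight) (f ∘ inRight) g ∧
      ∀ i, g (B.tip i) = b i)
    (h1 : b 1 = a 2) (h2 : b 0 = a 3) :
    ∃ g, (prod A B).IsPotential out g ∧ IsSplitting out f g ∧
      ∀ i, g ((prod A B).tip i) = ![a 0, a 1, b 2, b 3] i := by
  obtain ⟨u, hu, hus, hut⟩ := hA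
  obtain ⟨v, hv, hvs, hvt⟩ := hB
  refine ⟨elim u v, isPotential_prod.2 ⟨hu, hv, ?_, ?_⟩, hus.elim hvs, fun i => ?_⟩
  · exact (hvt 1).trans (h1.trans (hut 2).symm)
  · exact (hvt 0).trans (h2.trans (hut 3).symm)
  · fin_cases i
    exacts [hut 0, hut 1, hvt 2, hvt 3]

end Sum

end Tangle

/-! ### Every oriented alternating tangle smooths like one crossing -/

namespace Tangle

/-- The direction flips at each passage along a Seifert arc or a connecting arc; an odd number of
flips is a flip. -/
theorem ne_of_ne_of_ne_of_ne {p q r s : Bool} (h₁ : p ≠ q) (h₂ : q ≠ r) (h₃ : r ≠ s) : p ≠ s := by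
  revert p q r s
  decide

theorem add_sub_eq_of_eq {x y k : ℤ} (h : x = y) : x + (k - y) = k := by
  rw [h, add_sub_cancel]

/-- A vertical crossing is split by `f` itself, a horizontal one by a constant. -/
theorem isVertical_or_isHorizontal_crossing {ε : ℤˣ} {out : Unit × Fin 4 → Bool}
    (ho : (crossing ε).IsOrientation out) :
    (crossing ε).IsVertical out ∨ (crossing ε).IsHorizontal out := by
  have h0 : out ((), 2) = !out ((), 0) := ho.1 () 0
  have h1 : out ((), 3) = !out ((), 1) := ho.1 () 1
  by_cases h : out ((), 0) = out ((), 1)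
  · have s0 : out ((), 0) ≠ out ((), 3) := by simp_all
    have s1 : out ((), 2) ≠ out ((), 1) := by simp_all
    exact Or.inl ⟨s0, s1.symm, fun f hf => hf.2 () 3 s0, fun f hf => (hf.2 () 1 s1).symm,
      fun f hf => ⟨f, hf, fun _ => ⟨fun _ => rfl, fun h' => absurd h h'⟩, fun _ => rfl⟩⟩
  · have s0 : out ((), 1) ≠ out ((), 0) := fun h' => h h'.symm
    have s1 : out ((), 3) ≠ out ((), 2) := by simpa [h0, h1] using s0
    exact Or.inr ⟨h, s1.symm, fun f hf => (hf.2 () 0 s0).symm, fun f hf => (hf.2 () 2 s1).symm,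
      fun f hf k => ⟨fun _ => k, ⟨fun _ _ _ => rfl, fun _ _ _ => rfl⟩,
        fun _ => ⟨fun h' => absurd h' h, fun _ => rfl⟩, fun _ => rfl⟩⟩

section Sum

variable {A B : Tangle} {out : (A.Crossing ⊕ B.Crossing) × Fin 4 → Bool}

/-- A sum is horizontal exactly when both summands are. In a mixed sum the vertical summand closes
off one side of the horizontal one, whose four ends then lie on a single Seifert arc. -/
theorem isVertical_or_isHorizontal_sum (ho : (sum A B).IsOrientation out)
    (hA : A.IsVertical (out ∘ inLeft) ∨ A.IsHorizontal (out ∘ inLeft))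
    (hB : B.IsVertical (out ∘ inRight) ∨ B.IsHorizontal (out ∘ inRight)) :
    (sum A B).IsVertical out ∨ (sum A B).IsHorizontal out := by
  obtain ⟨-, -, o1, o2⟩ := isOrientation_sum ho
  rcases hA with hA | hA <;> rcases hB with hB | hB
  · refine Or.inl ⟨hB.1, hA.2, fun f hf => hB.3 _ (isPotential_sum.1 hf).2.1,
      fun f hf => hA.4 _ (isPotential_sum.1 hf).1, fun f hf => ?_⟩
    obtain ⟨hfA, hfB, h1, h2⟩ := isPotential_sum.1 hf
    obtain ⟨g, hg, hs, ht⟩ :=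
      exists_splitting_sum (hA.5 _ hfA) (hB.5 _ hfB) h1 h2
    refine ⟨g, hg, hs, fun i => (ht i).trans ?_⟩
    fin_cases i <;> rfl
  -- The right arc of `A` joins the upper and lower arcs of `B` into one, so the free level of `B`
  -- can be set to the value on that arc.
  · have key : ∀ f, (sum A B).IsPotential out f →
        f (inRight (B.tip 0)) = f (inLeft (A.tip 0)) ∧
        f (inRight (B.tip 3)) = f (inLeft (A.tip 0)) := by
      intro f hf
      obtain ⟨hfA, hfB, h1, h2⟩ := isPotential_sum.1 hf
      exact ⟨(hB.3 _ hfB).trans h1, (hB.4 _ hfB).symm.trans (h2.trans (hA.3 _ hfA).symm)⟩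
    refine Or.inl ⟨?_, hA.2, fun f hf => (key f hf).1.trans (key f hf).2.symm,
      fun f hf => hA.4 _ (isPotential_sum.1 hf).1, fun f hf => ?_⟩
    · exact ne_of_ne_of_ne_of_ne hB.1 o1 (ne_of_ne_of_ne_of_ne hA.1 o2.symm hB.2)
    · obtain ⟨hfA, hfB, h1, h2⟩ := isPotential_sum.1 hf
      obtain ⟨g, hg, hs, ht⟩ :=
        exists_splitting_sum (hA.5 _ hfA) (hB.5 _ hfB (f (inLeft (A.tip 0)))) rfl (hA.3 _ hfA)
      refine ⟨g, hg, hs, fun i => (ht i).trans ?_⟩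
      fin_cases i
      exacts [(key f hf).1.symm, rfl, rfl, (key f hf).2.symm]
  · have key : ∀ f, (sum A B).IsPotential out f →
        f (inLeft (A.tip 1)) = f (inRight (B.tip 1)) ∧
        f (inLeft (A.tip 2)) = f (inRight (B.tip 1)) := by
      intro f hf
      obtain ⟨hfA, hfB, h1, h2⟩ := isPotential_sum.1 hf
      exact ⟨(hA.3 _ hfA).symm.trans h1.symm, (hA.4 _ hfA).trans (h2.symm.trans (hB.4 _ hfB).symm)⟩
    refine Or.inl ⟨hB.1, ?_, fun f hf => hB.3 _ (isPotential_sum.1 hf).2.1,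
      fun f hf => (key f hf).1.trans (key f hf).2.symm, fun f hf => ?_⟩
    · exact ne_of_ne_of_ne_of_ne hA.1.symm o1.symm (ne_of_ne_of_ne_of_ne hB.2 o2 hA.2.symm)
    · obtain ⟨hfA, hfB, h1, h2⟩ := isPotential_sum.1 hf
      obtain ⟨g, hg, hs, ht⟩ := exists_splitting_sum
        (hA.5 _ hfA (f (inRight (B.tip 1)))) (hB.5 _ hfB) rfl (hB.4 _ hfB).symm
      refine ⟨g, hg, hs, fun i => (ht i).trans ?_⟩
      fin_cases i
      exacts [rfl, (key f hf).1.symm, (key f hf).2.symm, rfl]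
  · refine Or.inr ⟨?_, ?_, fun f hf => ?_, fun f hf => ?_, fun f hf k => ?_⟩
    · exact ne_of_ne_of_ne_of_ne hB.1 o1 hA.1
    · exact ne_of_ne_of_ne_of_ne hA.2 o2.symm hB.2
    · obtain ⟨hfA, hfB, h1, h2⟩ := isPotential_sum.1 hf
      exact (hB.3 _ hfB).trans (h1.trans (hA.3 _ hfA))
    · obtain ⟨hfA, hfB, h1, h2⟩ := isPotential_sum.1 hf
      exact (hA.4 _ hfA).trans (h2.symm.trans (hB.4 _ hfB))
    · obtain ⟨hfA, hfB, -, -⟩ := isPotential_sum.1 hf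
      obtain ⟨g, hg, hs, ht⟩ := exists_splitting_sum (hA.5 _ hfA k) (hB.5 _ hfB k) rfl rfl
      refine ⟨g, hg, hs, fun i => (ht i).trans ?_⟩
      fin_cases i <;> rfl

/-- A product is vertical exactly when both factors are. In a mixed product the four ends of the
vertical factor lie on one Seifert arc; its splitting keeps them equal and is shifted to the level
`k` chosen for the horizontal factor. -/
theorem isVertical_or_isHorizontal_prod (ho : (prod A B).IsOrientation out)
    (hA : A.IsVertical (out ∘ inLeft) ∨ A.IsHorizontal (out ∘ inLeft))
    (hB : B.IsVertical (out ∘ inRight) ∨ B.IsHorizontal (out ∘ inRight)) :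
    (prod A B).IsVertical out ∨ (prod A B).IsHorizontal out := by
  obtain ⟨-, -, o1, o2⟩ := isOrientation_prod ho
  rcases hA with hA | hA <;> rcases hB with hB | hB
  · refine Or.inl ⟨?_, ?_, fun f hf => ?_, fun f hf => ?_, fun f hf => ?_⟩
    · exact ne_of_ne_of_ne_of_ne hA.1 o2.symm hB.1
    · exact ne_of_ne_of_ne_of_ne hA.2 o1.symm hB.2
    · obtain ⟨hfA, hfB, h1, h2⟩ := isPotential_prod.1 hf
      exact (hA.3 _ hfA).trans (h2.symm.trans (hB.3 _ hfB))
    · obtain ⟨hfA, hfB, h1, h2⟩ := isPotential_prod.1 hf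
      exact (hA.4 _ hfA).trans (h1.symm.trans (hB.4 _ hfB))
    · obtain ⟨hfA, hfB, h1, h2⟩ := isPotential_prod.1 hf
      obtain ⟨g, hg, hs, ht⟩ :=
        exists_splitting_prod (hA.5 _ hfA) (hB.5 _ hfB) h1 h2
      refine ⟨g, hg, hs, fun i => (ht i).trans ?_⟩
      fin_cases i <;> rfl
  · have key : ∀ f, (prod A B).IsPotential out f →
        f (inLeft (A.tip 0)) = f (inRight (B.tip 1)) ∧
        f (inLeft (A.tip 1)) = f (inRight (B.tip 1)) ∧
        f (inLeft (A.tip 2)) = f (inRight (B.tip 1)) ∧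
        f (inLeft (A.tip 3)) = f (inRight (B.tip 1)) := by
      intro f hf
      obtain ⟨hfA, hfB, h1, h2⟩ := isPotential_prod.1 hf
      exact ⟨(hA.3 _ hfA).trans (h2.symm.trans (hB.3 _ hfB)), (hA.4 _ hfA).trans h1.symm, h1.symm,
        h2.symm.trans (hB.3 _ hfB)⟩
    refine Or.inr ⟨?_, hB.2, fun f hf => (key f hf).1.trans (key f hf).2.1.symm,
      fun f hf => hB.4 _ (isPotential_prod.1 hf).2.1, fun f hf k => ?_⟩
    · exact ne_of_ne_of_ne_of_ne hA.1 o2.symm (ne_of_ne_of_ne_of_ne hB.1 o1 hA.2.symm)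
    · obtain ⟨hfA, hfB, h1, h2⟩ := isPotential_prod.1 hf
      obtain ⟨k0, k1, k2, k3⟩ := key f hf
      obtain ⟨g, hg, hs, ht⟩ := exists_splitting_prod
        (hA.exists_splitting_add hfA (k - f (inRight (B.tip 1)))) (hB.5 _ hfB k)
        (add_sub_eq_of_eq k2).symm (add_sub_eq_of_eq k3).symm
      refine ⟨g, hg, hs, fun i => (ht i).trans ?_⟩
      fin_cases i
      exacts [add_sub_eq_of_eq k0, add_sub_eq_of_eq k1, rfl, rfl]
  -- Here the lower arc of `A` joins the left and right arcs of `B` into one.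
  · have key : ∀ f, (prod A B).IsPotential out f →
        f (inRight (B.tip 0)) = f (inLeft (A.tip 2)) ∧
        f (inRight (B.tip 1)) = f (inLeft (A.tip 2)) ∧
        f (inRight (B.tip 2)) = f (inLeft (A.tip 2)) ∧
        f (inRight (B.tip 3)) = f (inLeft (A.tip 2)) := by
      intro f hf
      obtain ⟨hfA, hfB, h1, h2⟩ := isPotential_prod.1 hf
      exact ⟨h2.trans (hA.4 _ hfA).symm, h1, (hB.4 _ hfB).symm.trans h1,
        (hB.3 _ hfB).symm.trans (h2.trans (hA.4 _ hfA).symm)⟩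
    refine Or.inr ⟨hA.1, ?_, fun f hf => hA.3 _ (isPotential_prod.1 hf).1,
      fun f hf => (key f hf).2.2.1.trans (key f hf).2.2.2.symm, fun f hf k => ?_⟩
    · exact ne_of_ne_of_ne_of_ne hB.2.symm o1 (ne_of_ne_of_ne_of_ne hA.2 o2.symm hB.1)
    · obtain ⟨hfA, hfB, h1, h2⟩ := isPotential_prod.1 hf
      obtain ⟨k0, k1, k2, k3⟩ := key f hf
      obtain ⟨g, hg, hs, ht⟩ := exists_splitting_prod (hA.5 _ hfA k)
        (hB.exists_splitting_add hfB (k - f (inLeft (A.tip 2))))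
        (add_sub_eq_of_eq k1) (add_sub_eq_of_eq k0)
      refine ⟨g, hg, hs, fun i => (ht i).trans ?_⟩
      fin_cases i
      exacts [rfl, rfl, add_sub_eq_of_eq k2, add_sub_eq_of_eq k3]
  · refine Or.inr ⟨hA.1, hB.2, fun f hf => hA.3 _ (isPotential_prod.1 hf).1,
      fun f hf => hB.4 _ (isPotential_prod.1 hf).2.1, fun f hf k => ?_⟩
    obtain ⟨hfA, hfB, -, -⟩ := isPotential_prod.1 hf
    obtain ⟨g, hg, hs, ht⟩ := exists_splitting_prod (hA.5 _ hfA k) (hB.5 _ hfB k) rfl rfl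
    refine ⟨g, hg, hs, fun i => (ht i).trans ?_⟩
    fin_cases i <;> rfl

end Sum

theorem IsAlternating.isVertical_or_isHorizontal {ε : ℤˣ} {T : Tangle} (hT : T.IsAlternating ε) :
    ∀ out, T.IsOrientation out → T.IsVertical out ∨ T.IsHorizontal out := by
  induction hT with
  | crossing => exact fun _ => isVertical_or_isHorizontal_crossing
  | sum _ _ hA hB =>
    intro out ho
    have h := isOrientation_sum ho
    exact isVertical_or_isHorizontal_sum ho (hA _ h.1) (hB _ h.2.1)
  | prod _ _ hA hB =>
    intro out ho
    have h := isOrientation_prod ho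
    exact isVertical_or_isHorizontal_prod ho (hA _ h.1) (hB _ h.2.1)

end Tangle

/-! ### Faces and connectedness of tangles -/

namespace Tangle

/-- `φ` is constant along the boundaries of the faces of `T`. -/
def IsFaceFunction (T : Tangle) (φ : T.Crossing × Fin 4 → Bool) : Prop :=
  ∀ h h', T.glue h = Sum.inl h' → φ (h'.1, h'.2 + 1) = φ h

/-- The face through which one enters at an end is the one through which one leaves at the next
end. -/
def IsDisc (T : Tangle) : Prop :=
  ∀ φ, T.IsFaceFunction φ → ∀ i, φ ((T.tip i).1, (T.tip i).2 + 1) = φ (T.tip (i + 1))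

/-- The face functions with given values on the faces at the boundary. -/
def FaceFiber (T : Tangle) (t : Fin 4 → Bool) : Type :=
  {φ // T.IsFaceFunction φ ∧ ∀ i, φ (T.tip i) = t i}

instance (T : Tangle) (t : Fin 4 → Bool) : Finite (T.FaceFiber t) :=
  have := T.finite
  inferInstanceAs (Finite {φ // T.IsFaceFunction φ ∧ ∀ i, φ (T.tip i) = t i})

section Sum

variable {A B : Tangle} {φ : (A.Crossing ⊕ B.Crossing) × Fin 4 → Bool}

/-- The two connecting arcs, each run through in both directions, give four conditions. Two of them
coincide by the disc property: they concern the face enclosed between the summands. The others match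
the faces above and below. -/
theorem isFaceFunction_sum (dA : A.IsDisc) (dB : B.IsDisc) : (sum A B).IsFaceFunction φ ↔
    A.IsFaceFunction (φ ∘ inLeft) ∧ B.IsFaceFunction (φ ∘ inRight) ∧
      φ (inRight (B.tip 2)) = φ (inLeft (A.tip 0)) ∧
      φ (inLeft (A.tip 1)) = φ (inRight (B.tip 1)) ∧
      φ (inRight (B.tip 3)) = φ (inLeft (A.tip 3)) := by
  constructor
  · intro H
    obtain ⟨hA, hB, ⟨h1, h2⟩, h3, h4⟩ := forall_glue_sum.1 H
    exact ⟨hA, hB, (dB (φ ∘ inRight) hB 1).symm.trans h1, (dA (φ ∘ inLeft) hA 0).symm.trans h2,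
      (dB (φ ∘ inRight) hB 2).symm.trans h3⟩
  · rintro ⟨hA, hB, h1, h2, h3⟩
    exact forall_glue_sum.2 ⟨hA, hB, ⟨(dB _ hB 1).trans h1, (dA _ hA 0).trans h2⟩,
      (dB _ hB 2).trans h3, (dA _ hA 3).trans h1.symm⟩

theorem isFaceFunction_prod (dA : A.IsDisc) (dB : B.IsDisc) : (prod A B).IsFaceFunction φ ↔
    A.IsFaceFunction (φ ∘ inLeft) ∧ B.IsFaceFunction (φ ∘ inRight) ∧
      φ (inRight (B.tip 1)) = φ (inLeft (A.tip 3)) ∧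
      φ (inRight (B.tip 2)) = φ (inLeft (A.tip 2)) ∧
      φ (inLeft (A.tip 0)) = φ (inRight (B.tip 0)) := by
  constructor
  · intro H
    obtain ⟨hA, hB, ⟨h1, h2⟩, h3, h4⟩ := forall_glue_prod.1 H
    exact ⟨hA, hB, (dB (φ ∘ inRight) hB 0).symm.trans h3, (dB (φ ∘ inRight) hB 1).symm.trans h1,
      (dA (φ ∘ inLeft) hA 3).symm.trans h4⟩
  · rintro ⟨hA, hB, h1, h2, h3⟩
    exact forall_glue_prod.2 ⟨hA, hB, ⟨(dB _ hB 1).trans h2, (dA _ hA 2).trans h1.symm⟩,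
      (dB _ hB 0).trans h1, (dA _ hA 3).trans h3⟩

theorem IsDisc.sum (dA : A.IsDisc) (dB : B.IsDisc) : (sum A B).IsDisc := by
  intro φ hφ i
  obtain ⟨hA, hB, h1, h2, h3⟩ := (isFaceFunction_sum dA dB).1 hφ
  fin_cases i
  · exact (dB _ hB 0).trans h2.symm
  · exact dA _ hA 1
  · exact (dA _ hA 2).trans h3.symm
  · exact dB _ hB 3

theorem IsDisc.prod (dA : A.IsDisc) (dB : B.IsDisc) : (prod A B).IsDisc := by
  intro φ hφ i
  obtain ⟨hA, hB, h1, h2, h3⟩ := (isFaceFunction_prod dA dB).1 hφ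
  fin_cases i
  · exact dA _ hA 0
  · exact (dA _ hA 1).trans h2.symm
  · exact dB _ hB 2
  · exact (dB _ hB 3).trans h3.symm

/-- A sum has one face in addition to those of the summands. -/
def faceFiberSum (dA : A.IsDisc) (dB : B.IsDisc) (t : Fin 4 → Bool) : (sum A B).FaceFiber t ≃
    Σ a : Bool, A.FaceFiber ![a, t 1, t 2, t 3] × B.FaceFiber ![t 0, t 1, a, t 3] where
  toFun φ := by
    have h := (isFaceFunction_sum dA dB).1 φ.2.1
    refine ⟨φ.1 (inLeft (A.tip 0)), ⟨φ.1 ∘ inLeft, h.1, fun i => ?_⟩,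
      φ.1 ∘ inRight, h.2.1, fun i => ?_⟩
    -- The free value `a` belongs to the face enclosed between `A` and `B`, seen from the NE end of
    -- `A` and the SW end of `B`.
    · fin_cases i
      exacts [rfl, φ.2.2 1, φ.2.2 2, h.2.2.2.2.symm.trans (φ.2.2 3)]
    · fin_cases i
      exacts [φ.2.2 0, h.2.2.2.1.symm.trans (φ.2.2 1), h.2.2.1, φ.2.2 3]
  invFun p := ⟨elim p.2.1.1 p.2.2.1, (isFaceFunction_sum dA dB).2 ⟨p.2.1.2.1, p.2.2.2.1,
      (p.2.2.2.2 2).trans (p.2.1.2.2 0).symm, (p.2.1.2.2 1).trans (p.2.2.2.2 1).symm,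
      (p.2.2.2.2 3).trans (p.2.1.2.2 3).symm⟩, fun i => by
    fin_cases i
    exacts [p.2.2.2.2 0, p.2.1.2.2 1, p.2.1.2.2 2, p.2.2.2.2 3]⟩
  left_inv φ := Subtype.ext (elim_inLeft_inRight φ.1)
  right_inv := by
    rintro ⟨a, ⟨u, hu, hut⟩, v, hv, hvt⟩
    obtain rfl : u (A.tip 0) = a := hut 0
    rfl

/-- A product has one face in addition to those of the factors. -/
def faceFiberProd (dA : A.IsDisc) (dB : B.IsDisc) (t : Fin 4 → Bool) : (prod A B).FaceFiber t ≃
    Σ a : Bool, A.FaceFiber ![t 0, t 1, t 2, a] × B.FaceFiber ![t 0, a, t 2, t 3] where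
  toFun φ := by
    have h := (isFaceFunction_prod dA dB).1 φ.2.1
    refine ⟨φ.1 (inLeft (A.tip 3)), ⟨φ.1 ∘ inLeft, h.1, fun i => ?_⟩,
      φ.1 ∘ inRight, h.2.1, fun i => ?_⟩
    · fin_cases i
      exacts [φ.2.2 0, φ.2.2 1, h.2.2.2.1.symm.trans (φ.2.2 2), rfl]
    · fin_cases i
      exacts [h.2.2.2.2.symm.trans (φ.2.2 0), h.2.2.1, φ.2.2 2, φ.2.2 3]
  invFun p := ⟨elim p.2.1.1 p.2.2.1, (isFaceFunction_prod dA dB).2 ⟨p.2.1.2.1, p.2.2.2.1,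
      (p.2.2.2.2 1).trans (p.2.1.2.2 3).symm, (p.2.2.2.2 2).trans (p.2.1.2.2 2).symm,
      (p.2.1.2.2 0).trans (p.2.2.2.2 0).symm⟩, fun i => by
    fin_cases i
    exacts [p.2.1.2.2 0, p.2.1.2.2 1, p.2.2.2.2 2, p.2.2.2.2 3]⟩
  left_inv φ := Subtype.ext (elim_inLeft_inRight φ.1)
  right_inv := by
    rintro ⟨a, ⟨u, hu, hut⟩, v, hv, hvt⟩
    obtain rfl : u (A.tip 3) = a := hut 3
    rfl

end Sum

theorem isDisc_crossing (ε : ℤˣ) : (crossing ε).IsDisc :=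
  fun _ _ _ => rfl

theorem card_faceFiber_crossing (ε : ℤˣ) (t : Fin 4 → Bool) :
    Nat.card ((crossing ε).FaceFiber t) = 1 := by
  refine Nat.card_eq_one_iff_exists.2 ⟨⟨fun h => t h.2, nofun, fun _ => rfl⟩, fun φ => ?_⟩
  exact Subtype.ext (funext fun h => φ.2.2 h.2)

theorem IsAlternating.isDisc {ε : ℤˣ} {T : Tangle} (hT : T.IsAlternating ε) : T.IsDisc := by
  induction hT with
  | crossing => exact isDisc_crossing ε
  | sum _ _ hA hB => exact hA.sum hB
  | prod _ _ hA hB => exact hA.prod hB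

/-- An alternating tangle with `n + 1` crossings has `n` inner faces. -/
theorem IsAlternating.exists_card {ε : ℤˣ} {T : Tangle} (hT : T.IsAlternating ε) :
    ∃ n, Nat.card T.Crossing = n + 1 ∧ ∀ t, Nat.card (T.FaceFiber t) = 2 ^ n := by
  induction hT with
  | crossing => exact ⟨0, Nat.card_unique (α := Unit), card_faceFiber_crossing ε⟩
  | @sum A B hA hB ihA ihB =>
    obtain ⟨m, hm, hA'⟩ := ihA
    obtain ⟨n, hn, hB'⟩ := ihB
    have := A.finite
    have := B.finite
    refine ⟨m + n + 1, ?_, fun t => ?_⟩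
    · change Nat.card (A.Crossing ⊕ B.Crossing) = _
      rw [Nat.card_sum, hm, hn]
      ring
    -- The enclosed face contributes the factor `2`, the summands `2 ^ m` and `2 ^ n`.
    · rw [Nat.card_congr (faceFiberSum hA.isDisc hB.isDisc t), Nat.card_sigma]
      simp only [Nat.card_prod, hA', hB']
      simp
      ring
  | @prod A B hA hB ihA ihB =>
    obtain ⟨m, hm, hA'⟩ := ihA
    obtain ⟨n, hn, hB'⟩ := ihB
    have := A.finite
    have := B.finite
    refine ⟨m + n + 1, ?_, fun t => ?_⟩
    · change Nat.card (A.Crossing ⊕ B.Crossing) = _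
      rw [Nat.card_sum, hm, hn]
      ring
    · rw [Nat.card_congr (faceFiberProd hA.isDisc hB.isDisc t), Nat.card_sigma]
      simp only [Nat.card_prod, hA', hB']
      simp
      ring

/-- Alternating tangles are connected. -/
theorem IsAlternating.eq_of_forall_glue {ε : ℤˣ} {T : Tangle} (hT : T.IsAlternating ε) :
    ∀ ψ : T.Crossing → Bool, (∀ h h', T.glue h = Sum.inl h' → ψ h'.1 = ψ h.1) →
      ∀ x y, ψ x = ψ y := by
  induction hT with
  | crossing => exact fun _ _ _ _ => rfl
  | @sum A B _ _ ihA ihB =>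
    intro ψ hψ
    obtain ⟨hA, hB, ⟨h, -⟩, -⟩ := forall_glue_sum.1 hψ
    have key : ∀ x y, ψ (Sum.inr y) = ψ (Sum.inl x) := fun x y =>
      (ihB (fun y => ψ (Sum.inr y)) hB _ _).trans (h.trans (ihA (fun x => ψ (Sum.inl x)) hA _ _))
    rintro (x | x) (y | y)
    exacts [ihA (fun x => ψ (Sum.inl x)) hA _ _, (key _ _).symm, key _ _,
      ihB (fun y => ψ (Sum.inr y)) hB _ _]
  | @prod A B _ _ ihA ihB =>
    intro ψ hψ
    obtain ⟨hA, hB, ⟨h, -⟩, -⟩ := forall_glue_prod.1 hψ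
    have key : ∀ x y, ψ (Sum.inr y) = ψ (Sum.inl x) := fun x y =>
      (ihB (fun y => ψ (Sum.inr y)) hB _ _).trans (h.trans (ihA (fun x => ψ (Sum.inl x)) hA _ _))
    rintro (x | x) (y | y)
    exacts [ihA (fun x => ψ (Sum.inl x)) hA _ _, (key _ _).symm, key _ _,
      ihB (fun y => ψ (Sum.inr y)) hB _ _]

end Tangle

/-! ### Replacing a crossing -/

/-- The functions on a quotient are the compatible functions. -/
def Quot.funEquiv {α : Type} (r : α → α → Prop) :
    (Quot r → Bool) ≃ {f : α → Bool // ∀ a b, r a b → f a = f b} where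
  toFun g := ⟨fun a => g (Quot.mk r a), fun _ _ h => congrArg g (Quot.sound h)⟩
  invFun f := Quot.lift f.1 f.2
  left_inv _ := funext (Quot.ind fun _ => rfl)
  right_inv _ := rfl

/-- This allows classes to be counted without handling the generated equivalence relation. -/
theorem Quot.two_pow_card {α : Type} [Finite α] (r : α → α → Prop) :
    2 ^ Nat.card (Quot r) = Nat.card {f : α → Bool // ∀ a b, r a b → f a = f b} := by
  rw [← Nat.card_congr (Quot.funEquiv r), Nat.card_fun, Nat.card_eq_fintype_card (α := Bool),
    Fintype.card_bool]

namespace Diagram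

variable {D : Diagram} {c : D.Crossing} {T : Tangle}

theorem port_self (i : Fin 4) : D.port c T (c, i) = Tangle.inRight (T.tip i) := by
  simp [port]

theorem port_of_ne {x : D.Crossing} (hx : x ≠ c) (i : Fin 4) :
    D.port c T (x, i) = (Sum.inl ⟨x, hx⟩, i) := by
  simp [port, hx]

theorem replace_glue_inRight {h h' : T.Crossing × Fin 4} (hh : T.glue h = Sum.inl h') :
    (D.replace c T).glue (Tangle.inRight h) = Tangle.inRight h' := by
  simp [replace, Tangle.inRight, hh]

theorem replace_glue_port (h : D.Crossing × Fin 4) :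
    (D.replace c T).glue (D.port c T h) = D.port c T (D.glue h) := by
  obtain ⟨x, i⟩ := h
  by_cases hx : x = c
  · subst hx
    rw [port_self]
    simp [replace, Tangle.inRight, T.glue_tip]
  · rw [port_of_ne hx]
    rfl

/-- The arcs after the replacement are those inside the tangle and those outside. -/
theorem forall_glue_replace {P : ({x // x ≠ c} ⊕ T.Crossing) × Fin 4 →
    ({x // x ≠ c} ⊕ T.Crossing) × Fin 4 → Prop} :
    (∀ h, P h ((D.replace c T).glue h)) ↔
      (∀ h h', T.glue h = Sum.inl h' → P (Tangle.inRight h) (Tangle.inRight h')) ∧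
      ∀ h, P (D.port c T h) (D.port c T (D.glue h)) := by
  constructor
  · intro H
    exact ⟨fun h h' hh => replace_glue_inRight (D := D) (c := c) hh ▸ H (Tangle.inRight h),
      fun h => replace_glue_port h ▸ H (D.port c T h)⟩
  · rintro ⟨H₁, H₂⟩ (h : ({x // x ≠ c} ⊕ T.Crossing) × Fin 4)
    obtain ⟨⟨x, hx⟩ | y, i⟩ := h
    · have := H₂ (x, i)
      rw [port_of_ne hx] at this
      exact this
    · rcases hT : T.glue (y, i) with h' | j
      · have := H₁ _ _ hT
        rw [← replace_glue_inRight (D := D) (c := c) hT] at this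
        exact this
      · have := H₂ (c, j)
        rw [← replace_glue_port, port_self, ← T.tip_of_glue _ _ hT] at this
        exact this

/-! ### Counting faces and components after the replacement -/

/-- `φ` is constant along the boundaries of the faces of `D`. -/
def IsFaceFunction (D : Diagram) (φ : D.Crossing × Fin 4 → Bool) : Prop :=
  ∀ h, φ ((D.glue h).1, (D.glue h).2 + 1) = φ h

/-- `ψ` is constant on the components of `D`. -/
def IsComponentFunction (D : Diagram) (ψ : D.Crossing → Bool) : Prop :=
  ∀ h, ψ (D.glue h).1 = ψ h.1

theorem two_pow_card_face (D : Diagram) :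
    2 ^ Nat.card D.Face = Nat.card {φ // D.IsFaceFunction φ} := by
  have := D.finite
  rw [Face, Quot.two_pow_card]
  refine Nat.card_congr (Equiv.subtypeEquivRight fun φ => ?_)
  exact ⟨fun H h => (H _ _ rfl).symm, fun H h h' hh => hh ▸ (H h).symm⟩

theorem two_pow_card_component (D : Diagram) :
    2 ^ Nat.card D.Component = Nat.card {ψ // D.IsComponentFunction ψ} := by
  have := D.finite
  rw [Component, Quot.two_pow_card]
  refine Nat.card_congr (Equiv.subtypeEquivRight fun ψ => ?_)
  constructor
  · exact fun H h => (H _ _ ⟨h.2, (D.glue h).2, rfl⟩).symm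
  · rintro H x y ⟨i, j, h⟩
    have := H (x, i)
    rw [h] at this
    exact this.symm

/-- The function after the replacement that is given by functions outside and inside the tangle. -/
def elim {K : Type} (u : D.Crossing × Fin 4 → K) (v : T.Crossing × Fin 4 → K) :
    ({x // x ≠ c} ⊕ T.Crossing) × Fin 4 → K :=
  Tangle.elim (fun h => u (h.1.1, h.2)) v

theorem elim_port {K : Type} {u : D.Crossing × Fin 4 → K} {v : T.Crossing × Fin 4 → K}
    (huv : ∀ i, v (T.tip i) = u (c, i)) (h : D.Crossing × Fin 4) :
    elim u v (D.port c T h) = u h := by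
  obtain ⟨x, i⟩ := h
  by_cases hx : x = c
  · subst hx
    rw [port_self]
    exact huv i
  · rw [port_of_ne hx]
    rfl

theorem elim_port_inRight {K : Type} (f : ({x // x ≠ c} ⊕ T.Crossing) × Fin 4 → K) :
    elim (fun h => f (D.port c T h)) (f ∘ Tangle.inRight) = f := by
  funext h
  obtain ⟨⟨x, hx⟩ | y, i⟩ := h
  · exact congrArg f (port_of_ne hx i)
  · rfl

/-- By the disc property, going around inside the tangle from one end to the next has the same
effect as turning at `c`. -/
theorem isFaceFunction_replace (hT : T.IsDisc)
    {φ : ({x // x ≠ c} ⊕ T.Crossing) × Fin 4 → Bool} : (D.replace c T).IsFaceFunction φ ↔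
      T.IsFaceFunction (φ ∘ Tangle.inRight) ∧ D.IsFaceFunction fun h => φ (D.port c T h) := by
  have key : T.IsFaceFunction (φ ∘ Tangle.inRight) → ∀ h : D.Crossing × Fin 4,
      φ ((D.port c T h).1, (D.port c T h).2 + 1) = φ (D.port c T (h.1, h.2 + 1)) := by
    rintro hφ ⟨x, i⟩
    by_cases hx : x = c
    · subst hx
      rw [port_self, port_self]
      exact hT _ hφ i
    · rw [port_of_ne hx, port_of_ne hx]
  refine (forall_glue_replace (P := fun h h' => φ (h'.1, h'.2 + 1) = φ h)).trans ?_
  exact and_congr_right fun hφ => forall_congr' fun h => by rw [key hφ]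

theorem sigma_faceFiber_ext
    {p q : Σ φ : {φ // D.IsFaceFunction φ}, T.FaceFiber fun i => φ.1 (c, i)}
    (h₁ : p.1.1 = q.1.1) (h₂ : p.2.1 = q.2.1) : p = q := by
  obtain ⟨⟨u, hu⟩, v, hv⟩ := p
  obtain ⟨⟨u', hu'⟩, v', hv'⟩ := q
  obtain rfl : u = u' := h₁
  obtain rfl : v = v' := h₂
  rfl

/-- The faces after the replacement are those of the diagram and the inner faces of the tangle. -/
noncomputable def faceFunctionReplace (hT : T.IsDisc) : {φ // (D.replace c T).IsFaceFunction φ} ≃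
    Σ φ : {φ // D.IsFaceFunction φ}, T.FaceFiber fun i => φ.1 (c, i) where
  toFun φ :=
    have h := (isFaceFunction_replace hT).1 φ.2
    ⟨⟨_, h.2⟩, _, h.1, fun i => congrArg φ.1 (port_self i).symm⟩
  invFun p := ⟨elim p.1.1 p.2.1, (isFaceFunction_replace hT).2 ⟨p.2.2.1, by
    simp only [elim_port p.2.2.2]
    exact p.1.2⟩⟩
  left_inv φ := Subtype.ext (elim_port_inRight φ.1)
  right_inv p := sigma_faceFiber_ext (funext (elim_port p.2.2.2)) rfl

/-- Since the tangle is connected, a component function is constant on it, and this constant plays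
the role of the value at `c`. -/
theorem card_component_replace {ε : ℤˣ} (hT : T.IsAlternating ε) :
    Nat.card (D.replace c T).Component = Nat.card D.Component := by
  refine Nat.pow_right_injective le_rfl ?_
  change 2 ^ _ = 2 ^ _
  rw [two_pow_card_component, two_pow_card_component]
  have hconst : ∀ ψ : {x // x ≠ c} ⊕ T.Crossing → Bool, (D.replace c T).IsComponentFunction ψ →
      ∀ y y', ψ (Sum.inr y) = ψ (Sum.inr y') := fun ψ hψ =>
    hT.eq_of_forall_glue (fun y => ψ (Sum.inr y))
      (forall_glue_replace (P := fun h h' => ψ h'.1 = ψ h.1).1 hψ).1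
  -- The half-edges of `c` may go to different crossings of the tangle; connectedness makes the
  -- index irrelevant, so index `0` can stand for all.
  have hfst : ∀ ψ : {x // x ≠ c} ⊕ T.Crossing → Bool, (D.replace c T).IsComponentFunction ψ →
      ∀ h, ψ (D.port c T h).1 = ψ (D.port c T (h.1, 0)).1 := by
    rintro ψ hψ ⟨x, i⟩
    by_cases hx : x = c
    · subst hx
      rw [port_self, port_self]
      exact hconst ψ hψ _ _
    · rw [port_of_ne hx, port_of_ne hx]
  refine Nat.card_congr
    { toFun ψ := ⟨fun x => ψ.1 (D.port c T (x, 0)).1, fun h => ?_⟩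
      invFun ψ := ⟨Sum.elim (fun x => ψ.1 x.1) fun _ => ψ.1 c, ?_⟩
      left_inv ψ := ?_
      right_inv ψ := ?_ }
  · change ψ.1 (D.port c T ((D.glue h).1, 0)).1 = ψ.1 (D.port c T (h.1, 0)).1
    rw [← hfst _ ψ.2, ← hfst _ ψ.2]
    exact (forall_glue_replace (P := fun h h' => ψ.1 h'.1 = ψ.1 h.1).1 ψ.2).2 h
  · refine (forall_glue_replace (P := fun h h' => Sum.elim (fun x => ψ.1 x.1) (fun _ => ψ.1 c) h'.1
      = Sum.elim (fun x => ψ.1 x.1) (fun _ => ψ.1 c) h.1)).2 ⟨fun _ _ _ => rfl, fun h => ?_⟩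
    have key : ∀ h, Sum.elim (fun x => ψ.1 x.1) (fun _ => ψ.1 c) (D.port c T h).1 = ψ.1 h.1 := by
      rintro ⟨x, i⟩
      by_cases hx : x = c
      · subst hx
        rw [port_self]
        rfl
      · rw [port_of_ne hx]
        rfl
    rw [key, key]
    exact ψ.2 h
  · refine Subtype.ext (funext fun x => ?_)
    rcases x with ⟨x, hx⟩ | y
    · change ψ.1 (D.port c T (x, 0)).1 = _
      rw [port_of_ne hx]
    · change ψ.1 (D.port c T (c, 0)).1 = _
      rw [port_self]
      exact hconst _ ψ.2 _ _
  · refine Subtype.ext (funext fun x => ?_)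
    change Sum.elim (fun x => ψ.1 x.1) (fun _ => ψ.1 c) (D.port c T (x, 0)).1 = ψ.1 x
    by_cases hx : x = c
    · subst hx
      rw [port_self]
      rfl
    · rw [port_of_ne hx]
      rfl

/-- A planar diagram remains planar when a crossing is replaced by an alternating tangle. -/
theorem IsPlanar.replace (hD : D.IsPlanar) {ε : ℤˣ} (hT : T.IsAlternating ε) :
    (D.replace c T).IsPlanar := by
  classical
  obtain ⟨n, hn, hfiber⟩ := hT.exists_card
  have := D.finite
  have := T.finite
  have := Fintype.ofFinite D.Crossing
  have hF : Nat.card (D.replace c T).Face = Nat.card D.Face + n := by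
    refine Nat.pow_right_injective le_rfl ?_
    change 2 ^ _ = 2 ^ _
    have := Fintype.ofFinite {φ // D.IsFaceFunction φ}
    rw [pow_add, two_pow_card_face, two_pow_card_face,
      Nat.card_congr (faceFunctionReplace hT.isDisc), Nat.card_sigma]
    simp only [hfiber]
    simp
  have hV : Nat.card (D.replace c T).Crossing = Nat.card D.Crossing + n := by
    change Nat.card ({x // x ≠ c} ⊕ T.Crossing) = _
    have h1 : Nat.card {x // x ≠ c} + 1 = Nat.card D.Crossing := by
      rw [Nat.card_eq_fintype_card, Nat.card_eq_fintype_card, Fintype.card_subtype_compl,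
        Fintype.card_subtype_eq]
      exact Nat.sub_add_cancel (Fintype.card_pos_iff.2 ⟨c⟩)
    rw [Nat.card_sum, hn, ← h1]
    ring
  -- Both sides of Euler's formula grow by `n`.
  rw [IsPlanar, hF, hV, card_component_replace hT, hD]
  ring

end Diagram

/-! ### Homogeneity -/

namespace OrientedDiagram

open Diagram

/-- `f` is constant along the Seifert circles of `D`. -/
structure IsPotential (D : OrientedDiagram) (f : D.Crossing × Fin 4 → ℤ) : Prop where
  glue : ∀ h, f (D.glue h) = f h
  smooth : ∀ x i, D.out (x, i + 1) ≠ D.out (x, i) → f (x, i + 1) = f (x, i)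

variable {D : OrientedDiagram}

theorem isPotential_iff {f : D.Crossing × Fin 4 → ℤ} : D.IsPotential f ↔
    ∀ h h' : D.Crossing × Fin 4,
      h' = D.glue h ∨ (h' = (h.1, h.2 + 1) ∧ D.out h' ≠ D.out h) → f h = f h' := by
  constructor
  · rintro ⟨h1, h2⟩ h h' (rfl | ⟨rfl, ho⟩)
    exacts [(h1 h).symm, (h2 _ _ ho).symm]
  · exact fun H => ⟨fun h => (H _ _ (Or.inl rfl)).symm,
      fun x i ho => (H (x, i) _ (Or.inr ⟨rfl, ho⟩)).symm⟩

/-- `D` is homogeneous if and only if potentials on the Seifert circles split along the crossings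
of type `ε` and those of type `-ε`. -/
theorem isHomogeneous_iff (ε : ℤˣ) : D.IsHomogeneous ↔
    ∀ f, D.IsPotential f → ∃ g, D.IsPotential g ∧
      ∀ x, (D.crossingType x = ε → g (x, 0) - g (x, 2) = f (x, 0) - f (x, 2)) ∧
        (D.crossingType x ≠ ε → g (x, 0) = g (x, 2)) := by
  have := D.finite
  have : Finite D.SeifertCircle := Quot.finite _
  -- There are only two types, so having equal types means being both inside or both outside the
  -- class of type `ε`.
  have hiff : D.IsHomogeneous ↔ D.seifertGraph.SplitsAlong {x | D.crossingType x = ε} := by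
    rw [Graph.splitsAlong_iff_blocks]
    refine forall₂_congr fun B _ => forall₂_congr fun x _ => forall₂_congr fun y _ => ?_
    change _ ↔ (D.crossingType x = ε ↔ D.crossingType y = ε)
    rcases Int.units_eq_one_or (D.crossingType x) with hx | hx <;>
    rcases Int.units_eq_one_or (D.crossingType y) with hy | hy <;>
    rcases Int.units_eq_one_or ε with rfl | rfl <;> rw [hx, hy] <;> decide
  rw [hiff]
  constructor
  · intro H f hf
    -- Components without crossings are isolated vertices, so the value `0` there is immaterial.
    obtain ⟨h, hh⟩ := H (Sum.elim (Quot.lift f (isPotential_iff.1 hf)) 0)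
    refine ⟨fun k => h (Sum.inl (Quot.mk _ k)), isPotential_iff.2 fun k k' hk => ?_, fun x => ?_⟩
    · exact congrArg (fun q => h (Sum.inl q)) (Quot.sound hk)
    · exact hh x _ _ (Or.inl ⟨rfl, rfl⟩)
  · intro H f
    obtain ⟨g, hg, hs⟩ := H (fun k => f (Sum.inl (Quot.mk _ k)))
      (isPotential_iff.2 fun k k' hk => congrArg (fun q => f (Sum.inl q)) (Quot.sound hk))
    refine ⟨Sum.elim (Quot.lift g (isPotential_iff.1 hg)) 0, ?_⟩
    rintro x _ _ (⟨rfl, rfl⟩ | ⟨rfl, rfl⟩)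
    · exact hs x
    · refine ⟨fun hx => ?_, fun hx => ((hs x).2 hx).symm⟩
      have := (hs x).1 hx
      change g (x, 2) - g (x, 0) = f (Sum.inl (Quot.mk _ (x, 2))) - f (Sum.inl (Quot.mk _ (x, 0)))
      linarith

variable {c : D.Crossing} {T : Tangle} {o : T.Orientation}
  {ho : ∀ i, o.out (T.tip i) = D.out (c, i)}

theorem isPotential_replace {f : ({x // x ≠ c} ⊕ T.Crossing) × Fin 4 → ℤ} :
    (D.replace c T o ho).IsPotential f ↔ T.IsPotential o.out (f ∘ Tangle.inRight) ∧
      (∀ h, f (D.port c T (D.glue h)) = f (D.port c T h)) ∧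
      ∀ x ≠ c, ∀ i, D.out (x, i + 1) ≠ D.out (x, i) →
        f (D.port c T (x, i + 1)) = f (D.port c T (x, i)) := by
  constructor
  · rintro ⟨h1, h2⟩
    obtain ⟨hT, hD⟩ := (forall_glue_replace (P := fun h h' => f h' = f h)).1 h1
    refine ⟨⟨hT, fun y i => h2 (Sum.inr y) i⟩, hD, fun x hx i => ?_⟩
    rw [port_of_ne hx, port_of_ne hx]
    exact h2 (Sum.inl ⟨x, hx⟩) i
  · rintro ⟨hT, hD, hx⟩
    refine ⟨(forall_glue_replace (P := fun h h' => f h' = f h)).2 ⟨hT.1, hD⟩, ?_⟩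
    rintro (⟨x, hxc⟩ | y) i
    · have := hx x hxc i
      rw [port_of_ne hxc, port_of_ne hxc] at this
      exact this
    · exact hT.2 y i

/-- This links types to orientations: among crossings of one sign the type records only the
direction of smoothing, which is why `IsSplitting` mentions no signs. -/
theorem crossingType_eq_iff {ε : ℤˣ} {x : D.Crossing} (hx : D.sign x = ε) :
    D.crossingType x = ε ↔ D.out (x, 0) = D.out (x, 1) := by
  unfold crossingType
  split_ifs with h
  · simp [h, hx]
  · simp only [h, hx, iff_false]
    exact units_ne_neg_self ε ∘ Eq.symm

/-- Outside the tangle nothing changes, so only the smoothing at `c` has to be supplied; it holds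
when the Seifert arcs of the tangle join the ends as the smoothing of `c` does. -/
theorem isPotential_port_of_isPotential {f : ({x // x ≠ c} ⊕ T.Crossing) × Fin 4 → ℤ}
    (hf : (D.replace c T o ho).IsPotential f)
    (hc : ∀ i, D.out (c, i + 1) ≠ D.out (c, i) →
      f (Tangle.inRight (T.tip (i + 1))) = f (Tangle.inRight (T.tip i))) :
    D.IsPotential fun h => f (D.port c T h) := by
  obtain ⟨-, hg, hs⟩ := isPotential_replace.1 hf
  refine ⟨hg, fun x i hx => ?_⟩
  by_cases hxc : x = c
  · subst hxc
    simp only [port_self]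
    exact hc i hx
  · exact hs x hxc i hx

/-- Potentials of the diagram and of the tangle that agree at the ends of the tangle are glued. -/
theorem exists_splitting_replace {ε : ℤˣ} {f : ({x // x ≠ c} ⊕ T.Crossing) × Fin 4 → ℤ}
    {u : D.Crossing × Fin 4 → ℤ} {v : T.Crossing × Fin 4 → ℤ} (hsign : ∀ y, T.sign y = ε)
    (hu : D.IsPotential u) (hv : T.IsPotential o.out v)
    (hus : ∀ x ≠ c, (D.crossingType x = ε → u (x, 0) - u (x, 2) =
        f (D.port c T (x, 0)) - f (D.port c T (x, 2))) ∧
      (D.crossingType x ≠ ε → u (x, 0) = u (x, 2)))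
    (hvs : Tangle.IsSplitting o.out (f ∘ Tangle.inRight) v)
    (huv : ∀ i, v (T.tip i) = u (c, i)) :
    ∃ g, (D.replace c T o ho).IsPotential g ∧
      ∀ x, ((D.replace c T o ho).crossingType x = ε → g (x, 0) - g (x, 2) = f (x, 0) - f (x, 2)) ∧
        ((D.replace c T o ho).crossingType x ≠ ε → g (x, 0) = g (x, 2)) := by
  refine ⟨Diagram.elim u v, isPotential_replace.2 ⟨hv, fun h => ?_, fun x hx i hi => ?_⟩, ?_⟩
  · rw [elim_port huv, elim_port huv]
    exact hu.1 h
  · rw [elim_port huv, elim_port huv]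
    exact hu.2 x i hi
  · rintro (⟨x, hx⟩ | y)
    · have := hus x hx
      rw [port_of_ne hx, port_of_ne hx] at this
      exact this
    · have hy : (D.replace c T o ho).sign (Sum.inr y) = ε := hsign y
      rw [Ne, crossingType_eq_iff hy]
      exact hvs y

/-- A homogeneous diagram remains homogeneous when a crossing is replaced by an alternating tangle
with crossings of the same sign. -/
theorem IsHomogeneous.replace (hD : D.IsHomogeneous) (hT : T.IsAlternating (D.sign c)) :
    (D.replace c T o ho).IsHomogeneous := by
  rw [isHomogeneous_iff (D.sign c)] at hD ⊢
  have hc : D.crossingType c = D.sign c ↔ D.out (c, 0) = D.out (c, 1) := crossingType_eq_iff rfl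
  have o2 : D.out (c, 2) = !D.out (c, 0) := D.out_opposite c 0
  have o3 : D.out (c, 3) = !D.out (c, 1) := D.out_opposite c 1
  intro f hf
  have hfT := (isPotential_replace.1 hf).1
  -- The agreement of orientations at the corners makes `c` vertical or horizontal together with the
  -- tangle.
  rcases hT.isVertical_or_isHorizontal o.out ⟨o.out_opposite, o.out_glue⟩ with h | h
  · have f03 := h.zero_three _ hfT
    have f12 := h.one_two _ hfT
    have h03 := h.out_zero_three
    rw [ho, ho] at h03
    have h01 : D.out (c, 0) = D.out (c, 1) := by
      revert h03
      rw [o3]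
      cases D.out (c, 0) <;> cases D.out (c, 1) <;> decide
    have hport : D.IsPotential fun h => f (D.port c T h) := by
      refine isPotential_port_of_isPotential hf fun i hi => ?_
      fin_cases i
      · exact absurd h01.symm hi
      · exact f12.symm
      · exact absurd (o3.trans (h01 ▸ o2.symm)) hi
      · exact f03
    obtain ⟨u, hu, hus⟩ := hD _ hport
    -- Here `c` has type `ε = D.sign c`, so `u` and `f` have the same difference across it and
    -- differ by one constant at all four ends. The splitting of the tangle is shifted by this
    -- constant.
    obtain ⟨v, hv, hvs, hvt⟩ := h.exists_splitting_add hfT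
      (u (c, 0) - f (Tangle.inRight (T.tip 0)))
    refine exists_splitting_replace hT.sign_eq hu hv (fun x _ => hus x) hvs fun i => ?_
    have u03 : u (c, 0) = u (c, 3) := hu.2 c 3 h03
    have u12 : u (c, 2) = u (c, 1) := hu.2 c 1 (by rw [← h01]; simp [o2])
    have u02 := (hus c).1 (hc.2 h01)
    simp only [port_self] at u02
    simp only [Function.comp] at f03 f12 hvt
    have key : ∀ j, f (Tangle.inRight (T.tip j)) - f (Tangle.inRight (T.tip 0)) =
        u (c, j) - u (c, 0) := by
      intro j
      fin_cases j <;> simp only [Fin.zero_eta, Fin.mk_one, Fin.reduceFinMk] <;> linarith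
    rw [hvt]
    linarith [key i]
  · have f01 := h.zero_one _ hfT
    have f23 := h.two_three _ hfT
    have h01 := h.out_zero_one
    rw [ho, ho] at h01
    have h03 : D.out (c, 0) = D.out (c, 3) := by
      revert h01
      rw [o3]
      cases D.out (c, 0) <;> cases D.out (c, 1) <;> decide
    have h21 : D.out (c, 2) = D.out (c, 1) := by rw [o2, h03, o3, Bool.not_not]
    have hport : D.IsPotential fun h => f (D.port c T h) := by
      refine isPotential_port_of_isPotential hf fun i hi => ?_
      fin_cases i
      · exact f01.symm
      · exact absurd h21 hi
      · exact f23.symm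
      · exact absurd h03 hi
    obtain ⟨u, hu, hus⟩ := hD _ hport
    -- Here `c` has the opposite type, so `u` takes a single value at all four corners, and this is
    -- the level required of the tangle.
    obtain ⟨v, hv, hvs, hvt⟩ := h.exists_splitting _ hfT (u (c, 0))
    refine exists_splitting_replace hT.sign_eq hu hv (fun x _ => hus x) hvs fun i => ?_
    have u01 : u (c, 1) = u (c, 0) := hu.2 c 0 h01.symm
    have u23 : u (c, 3) = u (c, 2) := hu.2 c 2 (fun e => h01 (h03.trans (e.trans h21)))
    have u02 := (hus c).2 (mt hc.1 h01)
    rw [hvt]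
    fin_cases i
    exacts [rfl, u01.symm, u02, u02.trans u23.symm]

end OrientedDiagram

theorem mainTheorem2 (D : OrientedDiagram) (hplanar : D.IsPlanar) (hD : D.IsHomogeneous)
    (c : D.Crossing) (b : RationalBlock) (hb : b.Extends (D.sign c))
    (o : b.tangle.Orientation) (ho : ∀ i, o.out (b.tangle.tip i) = D.out (c, i)) :
    (D.replace c b.tangle o ho).IsPlanar ∧ (D.replace c b.tangle o ho).IsHomogeneous :=
  ⟨Diagram.IsPlanar.replace hplanar hb.isAlternating, hD.replace hb.isAlternating⟩
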